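/- For $\beta\in\mathbb R$, call $u\in C^4(\mathbb R^3)$ an entire radial solution with parameter $\beta$ if $u$ is radial, $\Delta^2u=e^u$ in $\mathbb R^3$, $u(0)=0$ and $\Delta u(0)=\beta$. There is a (necessarily unique) $\beta_0\in(-\infty,0)$ such that an entire radial solution with parameter $\beta$ exists if and only if $\beta\le\beta_0$. Let $u=u_{\beta_0}$ be the entire radial solution with parameter $\beta_0$ (the separatrix). Then $e^u$, $|x|e^u$ and $|x|^2e^u$ are integrable over $\mathbb R^3$, and there is $c>0$ such that, writing $u(r)$ for $u(x)$ with $|x|=r$, $$u(r)=\alpha_1r+\alpha_2+\alpha_3r^{-1}+O(e^{-cr})\qquad\text{as } r\to\infty,$$ where $$\alpha_1=-\frac1{8\pi}\int_{\mathbb R^3}e^{u}\,dx,\qquad \alpha_2=\frac1{8\pi}\int_{\mathbb R^3}|x|e^{u}\,dx,\qquad \alpha_3=-\frac1{24\pi}\int_{\mathbb R^3}|x|^2e^{u}\,dx.$$ -/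

import Mathlib

open MeasureTheory Filter Asymptotics
open scoped Laplacian

/-- The Euclidean space of dimension three. -/
abbrev E3 : Type := EuclideanSpace ℝ (Fin 3)

/-- `u` is an entire (defined on all of `ℝ³`) classical radial solution of `Δ² u = e ^ u` with
`u 0 = 0` and `Δ u 0 = β`. The conditions `u'(0) = (Δ u)'(0) = 0` on the profile are automatic,
because `u` and `Δ u` are radial and differentiable at the origin. -/
structure IsEntireRadialSolution (β : ℝ) (u : E3 → ℝ) : Prop where
  contDiff : ContDiff ℝ 4 u
  radial : ∀ x y : E3, ‖x‖ = ‖y‖ → u x = u y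
  bilaplacian_eq : ∀ x : E3, Δ (Δ u) x = Real.exp (u x)
  value_zero : u 0 = 0
  laplacian_zero : Δ u 0 = β

/-- `β₀` is the critical parameter: the radial solution with `u 0 = 0` and `Δ u 0 = β` is entire
exactly when `β ≤ β₀`. At most one real number has this property; the separatrix is the
entire radial solution with parameter `β₀`. -/
def IsCriticalParameter (β₀ : ℝ) : Prop :=
  ∀ β : ℝ, (∃ u : E3 → ℝ, IsEntireRadialSolution β u) ↔ β ≤ β₀

/-! Since r Δu = (r u)'' for radial u, inverting the Laplacian twice turns the problem into an
integral equation for the profile g. Equivalently, y = r g solves y'''' = r exp(y / r), and y''' = β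
+ ∫₀ʳ s e^g ds is nondecreasing.

Existence is monotone in β. The Picard iterates for e^g started from 0 increase in n and in β. If
they stay below 1 they converge to a profile (`IsAdmissible.exists_isProfile`). Conversely, if y'''
were positive somewhere, y would grow so fast that it blows up (`third_deriv_nonpos`). Hence y''' <
0 and g ≤ 0 for every profile, so the iterates stay below 1. Entire solutions therefore exist
exactly for admissible β. The admissible set is closed, downward closed, contains -7 and consists of
negative numbers; its supremum is β₀.

At β₀ the limit of y''' is 0: if y''' ≤ -δ everywhere, a Gaussian bound survives a small increase of
β, contradicting maximality (`IsProfile.exists_isAdmissible_add`). Also g lies below a decreasing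
affine function, so all moments of e^g have exponentially small tails. Expanding the kernel (r - s)³
/ 6 writes r g through the moments of orders 1 to 4. The cubic term cancels because the first moment
is -β₀, and the full moments of orders 2, 3, 4 give α₁, α₂, α₃. -/

section

open scoped Topology RealInnerProductSpace

noncomputable section

/-! ### The Laplacian of radial functions -/

/-- The Laplacian on `ℝ³` of a function of `‖x‖ ^ 2`. -/
theorem laplacian_comp_norm_sq {G G₁ : ℝ → ℝ} {G₂ : ℝ} (x : E3)
    (h₁ : ∀ᶠ t in 𝓝 (‖x‖ ^ 2), HasDerivAt G (G₁ t) t) (h₂ : HasDerivAt G₁ G₂ (‖x‖ ^ 2)) :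
    Δ (fun y : E3 => G (‖y‖ ^ 2)) x = 4 * ‖x‖ ^ 2 * G₂ + 6 * G₁ (‖x‖ ^ 2) := by
  have hn : ∀ y : E3, HasFDerivAt (fun y : E3 => ‖y‖ ^ 2) ((2 : ℝ) • innerSL ℝ y) y := fun y => by
    simpa [two_smul] using (hasStrictFDerivAt_norm_sq y).hasFDerivAt
  have hc : ContinuousAt (fun y : E3 => ‖y‖ ^ 2) x := by fun_prop
  have e₁ : ∀ᶠ y in 𝓝 x, fderiv ℝ (fun y : E3 => G (‖y‖ ^ 2)) y
      = (2 * G₁ (‖y‖ ^ 2)) • innerSL ℝ y := by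
    filter_upwards [hc.eventually h₁] with y hy
    have := (hy.comp_hasFDerivAt y (hn y)).fderiv
    rw [show (fun y : E3 => G (‖y‖ ^ 2)) = G ∘ (fun y : E3 => ‖y‖ ^ 2) from rfl, this, smul_smul,
      mul_comm]
  let I : E3 →L[ℝ] E3 →L[ℝ] ℝ := innerSL ℝ
  have e₂ : HasFDerivAt (fun y : E3 => (2 * G₁ (‖y‖ ^ 2)) • innerSL ℝ y)
      ((2 * G₁ (‖x‖ ^ 2)) • I +
        ((2 : ℝ) • (G₂ • ((2 : ℝ) • innerSL ℝ x))).smulRight (innerSL ℝ x)) x :=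
    ((h₂.comp_hasFDerivAt x (hn x)).const_mul 2).smul I.hasFDerivAt
  have e₃ := (e₂.congr_of_eventuallyEq e₁).fderiv
  have hI : ∀ y z : E3, I y z = ⟪y, z⟫ := fun _ _ => rfl
  clear_value I
  rw [InnerProductSpace.laplacian_eq_iteratedFDeriv_orthonormalBasis _
    (EuclideanSpace.basisFun (Fin 3) ℝ)]
  simp only [iteratedFDeriv_two_apply, e₃]
  simp [hI, Fin.sum_univ_three, EuclideanSpace.norm_sq_eq, EuclideanSpace.inner_single_right]
  ring

/-- The Laplacian of a `C²` radial function through its profile along a unit vector. -/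
theorem laplacian_of_radial {u : E3 → ℝ} (hu : ContDiff ℝ 2 u)
    (hr : ∀ x y : E3, ‖x‖ = ‖y‖ → u x = u y) {e : E3} (he : ‖e‖ = 1) {x : E3} (hx : x ≠ 0) :
    Δ u x = deriv (deriv fun s : ℝ => u (s • e)) ‖x‖
      + 2 * deriv (fun s : ℝ => u (s • e)) ‖x‖ / ‖x‖ := by
  set g : ℝ → ℝ := fun s => u (s • e) with hg
  have hgc : ContDiff ℝ 2 g := by fun_prop
  have d1 : ∀ s, HasDerivAt g (deriv g s) s := fun s =>
    (hgc.differentiable (by norm_num) s).hasDerivAt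
  have hgc' : ContDiff ℝ 1 (deriv g) := by
    have : ContDiff ℝ (1 + 1) g := by simpa [one_add_one_eq_two] using hgc
    exact (contDiff_succ_iff_deriv.1 this).2.2
  have d2 : ∀ s, HasDerivAt (deriv g) (deriv (deriv g) s) s := fun s =>
    (hgc'.differentiable (by norm_num) s).hasDerivAt
  have hpos : 0 < ‖x‖ := norm_pos_iff.2 hx
  have hx2 : 0 < ‖x‖ ^ 2 := by positivity
  -- The square root is differentiable only away from zero, which is why the origin is excluded.
  have key : u = fun y : E3 => (fun t => g (√t)) (‖y‖ ^ 2) := by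
    funext y
    apply hr
    simp [norm_smul, he]
  have h₁ : ∀ t : ℝ, 0 < t → HasDerivAt (fun t => g (√t)) (deriv g (√t) * (1 / (2 * √t))) t :=
    fun t ht => (d1 _).comp t (Real.hasDerivAt_sqrt ht.ne')
  have h₂ := ((d2 (√(‖x‖ ^ 2))).comp (‖x‖ ^ 2) (Real.hasDerivAt_sqrt hx2.ne')).mul
    (((Real.hasDerivAt_sqrt hx2.ne').const_mul 2).inv (by positivity))
  have := laplacian_comp_norm_sq x (G := fun t => g (√t))
    (G₁ := fun t => deriv g (√t) * (2 * √t)⁻¹) (Eventually.mono (eventually_gt_nhds hx2)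
      (fun t ht => by simpa using h₁ t ht)) h₂
  rw [← key] at this
  rw [this]
  simp only [Real.sqrt_sq hpos.le, Function.comp, Pi.inv_apply]
  field_simp
  ring

/-- This lets the inversion of the Laplacian be applied a second time, to `Δ u`. -/
theorem laplacian_radial {u : E3 → ℝ} (hu : ContDiff ℝ 2 u)
    (hr : ∀ x y : E3, ‖x‖ = ‖y‖ → u x = u y) (x y : E3) (h : ‖x‖ = ‖y‖) : Δ u x = Δ u y := by
  obtain ⟨e, he⟩ := exists_norm_eq E3 zero_le_one
  rcases eq_or_ne x 0 with rfl | hx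
  · rw [norm_zero, eq_comm, norm_eq_zero] at h
    rw [h]
  · have hy : y ≠ 0 := by rwa [← norm_ne_zero_iff, ← h, norm_ne_zero_iff]
    rw [laplacian_of_radial hu hr he hx, laplacian_of_radial hu hr he hy, h]

theorem contDiff_laplacian {u : E3 → ℝ} {m : ℕ} (hu : ContDiff ℝ (m + 2) u) :
    ContDiff ℝ m (Δ u) := by
  rw [InnerProductSpace.laplacian_eq_iteratedFDeriv_stdOrthonormalBasis]
  refine ContDiff.sum fun i _ => ?_
  have : ContDiff ℝ m (iteratedFDeriv ℝ 2 u) := by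
    refine hu.iteratedFDeriv_right (i := 2) ?_
    norm_num
  exact (ContinuousMultilinearMap.apply ℝ (fun _ : Fin 2 => E3) ℝ _).contDiff.comp this

/-! ### Calculus of the radial inverse Laplacian -/

/-- The weighted primitive `∫₀ʳ s h(s) ds`. -/
def moment (h : ℝ → ℝ) (r : ℝ) : ℝ := ∫ s in (0 : ℝ)..r, s * h s

/-- The inverse of the radial Laplacian of `ℝ³`, with zero value at the origin. -/
def invLap (h : ℝ → ℝ) (r : ℝ) : ℝ := ∫ θ in (0 : ℝ)..1, moment h (r * θ)

section Calculus

variable {h k : ℝ → ℝ}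

@[simp] theorem moment_zero : moment h 0 = 0 := by simp [moment]

@[simp] theorem invLap_zero : invLap h 0 = 0 := by simp [invLap]

theorem hasDerivAt_moment (hh : Continuous h) (r : ℝ) : HasDerivAt (moment h) (r * h r) r :=
  (continuous_id.mul hh).integral_hasStrictDerivAt 0 r |>.hasDerivAt

theorem continuous_moment (hh : Continuous h) : Continuous (moment h) :=
  continuous_iff_continuousAt.2 fun r => (hasDerivAt_moment hh r).continuousAt

/-- Only the primitive has to be continuous: the limit of the Picard iterates is at first merely
measurable. -/
theorem continuous_invLap_of_moment (hh : Continuous (moment h)) : Continuous (invLap h) :=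
  intervalIntegral.continuous_parametric_intervalIntegral_of_continuous' (by fun_prop) 0 1

theorem continuous_invLap (hh : Continuous h) : Continuous (invLap h) :=
  continuous_invLap_of_moment (continuous_moment hh)

theorem mul_invLap (h : ℝ → ℝ) (r : ℝ) : r * invLap h r = ∫ s in (0 : ℝ)..r, moment h s := by
  have := intervalIntegral.mul_integral_comp_mul_left (a := 0) (b := 1) (f := moment h) r
  rwa [mul_zero, mul_one] at this

theorem moment_congr {r : ℝ} (hr : 0 ≤ r) (H : ∀ s, 0 ≤ s → s ≤ r → h s = k s) :
    moment h r = moment k r := by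
  refine intervalIntegral.integral_congr fun s hs => ?_
  rw [Set.uIcc_of_le hr] at hs
  simp [H s hs.1 hs.2]

theorem invLap_congr {r : ℝ} (hr : 0 ≤ r) (H : ∀ s, 0 ≤ s → s ≤ r → h s = k s) :
    invLap h r = invLap k r := by
  refine intervalIntegral.integral_congr fun θ hθ => ?_
  rw [Set.uIcc_of_le zero_le_one] at hθ
  exact moment_congr (mul_nonneg hr hθ.1) fun s hs hs' =>
    H s hs (hs'.trans (mul_le_of_le_one_right hr hθ.2))

theorem moment_mono {r : ℝ} (hr : 0 ≤ r) (hh : Continuous h) (hk : Continuous k)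
    (H : ∀ s, 0 ≤ s → s ≤ r → h s ≤ k s) : moment h r ≤ moment k r :=
  intervalIntegral.integral_mono_on hr ((continuous_id.mul hh).intervalIntegrable _ _)
    ((continuous_id.mul hk).intervalIntegrable _ _)
    fun s hs => mul_le_mul_of_nonneg_left (H s hs.1 hs.2) hs.1

theorem invLap_mono {r : ℝ} (hr : 0 ≤ r) (hh : Continuous h) (hk : Continuous k)
    (H : ∀ s, 0 ≤ s → s ≤ r → h s ≤ k s) : invLap h r ≤ invLap k r := by
  have h1 := continuous_moment hh
  have h2 := continuous_moment hk
  refine intervalIntegral.integral_mono_on zero_le_one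
    (Continuous.intervalIntegrable (by fun_prop) _ _)
    (Continuous.intervalIntegrable (by fun_prop) _ _) fun θ hθ => ?_
  exact moment_mono (mul_nonneg hr hθ.1) hh hk fun s hs hs' =>
    H s hs (hs'.trans (mul_le_of_le_one_right hr hθ.2))

theorem moment_const (c r : ℝ) : moment (fun _ => c) r = c * r ^ 2 / 2 := by
  simp [moment]; ring

theorem invLap_const (c r : ℝ) : invLap (fun _ => c) r = c * r ^ 2 / 6 := by
  simp only [invLap, moment_const, mul_pow]
  rw [show (fun θ : ℝ => c * (r ^ 2 * θ ^ 2) / 2) = fun θ => (c * r ^ 2 / 2) * θ ^ 2 by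
    funext; ring]
  rw [intervalIntegral.integral_const_mul, integral_pow]
  norm_num; ring

theorem moment_add (hh : Continuous h) (hk : Continuous k) (r : ℝ) :
    moment (fun s => h s + k s) r = moment h r + moment k r := by
  simp only [moment, mul_add]
  exact intervalIntegral.integral_add ((continuous_id.mul hh).intervalIntegrable _ _)
    ((continuous_id.mul hk).intervalIntegrable _ _)

theorem invLap_add (hh : Continuous h) (hk : Continuous k) (r : ℝ) :
    invLap (fun s => h s + k s) r = invLap h r + invLap k r := by
  have h1 := continuous_moment hh
  have h2 := continuous_moment hk
  simp only [invLap, moment_add hh hk]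
  exact intervalIntegral.integral_add (Continuous.intervalIntegrable (by fun_prop) _ _)
    (Continuous.intervalIntegrable (by fun_prop) _ _)

theorem moment_nonneg {r : ℝ} (hr : 0 ≤ r) (H : ∀ s, 0 ≤ s → 0 ≤ h s) : 0 ≤ moment h r :=
  intervalIntegral.integral_nonneg hr fun s hs => mul_nonneg hs.1 (H s hs.1)

theorem moment_le_moment (hh : Continuous h) (H : ∀ s, 0 ≤ s → 0 ≤ h s) {r t : ℝ} (hr : 0 ≤ r)
    (hrt : r ≤ t) : moment h r ≤ moment h t := by
  have := intervalIntegral.integral_add_adjacent_intervals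
    ((continuous_id.mul hh).intervalIntegrable (μ := volume) 0 r)
    ((continuous_id.mul hh).intervalIntegrable r t)
  have h2 : 0 ≤ ∫ s in r..t, s * h s := intervalIntegral.integral_nonneg hrt fun s hs =>
    mul_nonneg (hr.trans hs.1) (H s (hr.trans hs.1))
  change moment h r + _ = moment h t at this
  exact this ▸ le_add_of_nonneg_right h2

/-- An average is at most the last value of a nondecreasing function. -/
theorem invLap_le_moment (hh : Continuous h) (H : ∀ s, 0 ≤ s → 0 ≤ h s) {r : ℝ} (hr : 0 ≤ r) :
    invLap h r ≤ moment h r := by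
  have h1 := continuous_moment hh
  have : invLap h r ≤ ∫ _θ in (0 : ℝ)..1, moment h r :=
    intervalIntegral.integral_mono_on zero_le_one
      (Continuous.intervalIntegrable (by fun_prop) _ _) (by simp) fun θ hθ =>
      moment_le_moment hh H (mul_nonneg hr hθ.1) (mul_le_of_le_one_right hr hθ.2)
  simpa using this

theorem invLap_nonneg (H : ∀ s, 0 ≤ s → 0 ≤ h s) {r : ℝ} (hr : 0 ≤ r) : 0 ≤ invLap h r :=
  intervalIntegral.integral_nonneg zero_le_one fun _ hθ =>
    moment_nonneg (mul_nonneg hr hθ.1) H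

/-- On [0, r] the inner average is at most `moment h r`, so the integrand is bounded by a constant.
An upper bound on the third derivative of r g thus becomes a quadratic upper bound on g. -/
theorem invLap_add_invLap_le (hh : Continuous h) (H : ∀ s, 0 ≤ s → 0 ≤ h s) (β : ℝ) {r : ℝ}
    (hr : 0 ≤ r) : invLap (fun s => β + invLap h s) r ≤ (β + moment h r) * r ^ 2 / 6 := by
  rw [← invLap_const]
  have h1 := continuous_invLap hh
  refine invLap_mono hr (by fun_prop) (by fun_prop) fun s hs hsr => ?_
  have := invLap_le_moment hh H hs
  have := moment_le_moment hh H hs hsr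
  linarith

end Calculus

/-! ### From solutions to the integral equation -/

/-- `g` is the profile on `[0, ∞)` of an entire radial solution with parameter `β`, as a solution
of an integral equation. -/
structure IsProfile (β : ℝ) (g : ℝ → ℝ) : Prop where
  continuous : Continuous g
  eq : ∀ r, 0 ≤ r → g r = invLap (fun s => β + invLap (fun t => Real.exp (g t)) s) r

/-- A `C²` radial function is recovered from its Laplacian. -/
theorem radial_eq_invLap {u : E3 → ℝ} (hu : ContDiff ℝ 2 u)
    (hr : ∀ x y : E3, ‖x‖ = ‖y‖ → u x = u y) {e : E3} (he : ‖e‖ = 1) {r : ℝ} (hr0 : 0 ≤ r) :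
    u (r • e) = u 0 + invLap (fun s => Δ u (s • e)) r := by
  rcases hr0.eq_or_lt with rfl | hrpos
  · simp
  set g : ℝ → ℝ := fun s => u (s • e) with hg
  have hgc : ContDiff ℝ 2 g := by fun_prop
  have d1 : ∀ s, HasDerivAt g (deriv g s) s := fun s =>
    (hgc.differentiable (by norm_num) s).hasDerivAt
  have hgc' : ContDiff ℝ 1 (deriv g) := by
    have : ContDiff ℝ (1 + 1) g := by simpa [one_add_one_eq_two] using hgc
    exact (contDiff_succ_iff_deriv.1 this).2.2
  have d2 : ∀ s, HasDerivAt (deriv g) (deriv (deriv g) s) s := fun s =>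
    (hgc'.differentiable (by norm_num) s).hasDerivAt
  have hlap : Continuous fun s : ℝ => Δ u (s • e) :=
    (contDiff_laplacian (m := 0) (by simpa using hu)).continuous.comp (by fun_prop)
  -- First integration of (s g)'' = s Δu; the second one follows in `e2`.
  have e1 : ∀ t, 0 ≤ t → g t + t * deriv g t = u 0 + moment (fun s => Δ u (s • e)) t := by
    intro t ht
    have := intervalIntegral.integral_eq_sub_of_hasDerivAt_of_le ht
      (f := fun s => g s + s * deriv g s) (f' := fun s => s * Δ u (s • e))
      (Continuous.continuousOn (hgc.continuous.add (continuous_id.mul hgc'.continuous)))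
      (fun s hs => ?_) ((continuous_id.mul hlap).intervalIntegrable _ _)
    · rw [moment, this]; simp [hg]
    · have hs0 : s • e ≠ 0 := smul_ne_zero hs.1.ne' (by rw [← norm_ne_zero_iff, he]; simp)
      have hn : ‖s • e‖ = s := by simp [norm_smul, he, abs_of_pos hs.1]
      have h3 := (d1 s).add ((hasDerivAt_id s).mul (d2 s))
      refine h3.congr_deriv ?_
      rw [laplacian_of_radial hu hr he hs0, hn]
      have := hs.1.ne'
      simp only [id]
      field_simp
      ring
  have e2 := intervalIntegral.integral_eq_sub_of_hasDerivAt_of_le hr0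
      (f := fun s => s * g s) (f' := fun s => u 0 + moment (fun s => Δ u (s • e)) s)
      (continuous_id.mul hgc.continuous).continuousOn
      (fun s hs => ((hasDerivAt_id s).mul (d1 s)).congr_deriv
        (by rw [← e1 s hs.1.le]; simp))
      (Continuous.intervalIntegrable (by have := continuous_moment hlap; fun_prop) _ _)
  rw [intervalIntegral.integral_add (by simp)
    ((continuous_moment hlap).intervalIntegrable _ _), ← mul_invLap] at e2
  simp only [intervalIntegral.integral_const, smul_eq_mul, sub_zero, zero_mul] at e2
  have e3 : r * (u (r • e) - (u 0 + invLap (fun s => Δ u (s • e)) r)) = 0 := by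
    change r * (g r - _) = 0
    linarith
  rcases mul_eq_zero.1 e3 with h | h <;> linarith

theorem IsEntireRadialSolution.isProfile {β : ℝ} {u : E3 → ℝ} (hu : IsEntireRadialSolution β u)
    {e : E3} (he : ‖e‖ = 1) : IsProfile β fun s => u (s • e) := by
  have hc := hu.contDiff
  have hu2 : ContDiff ℝ 2 u := hc.of_le (by norm_num)
  have hv2 : ContDiff ℝ 2 (Δ u) := contDiff_laplacian (m := 2) (hc.of_le (by norm_num))
  refine ⟨hc.continuous.comp (by fun_prop), fun r hr => ?_⟩
  rw [radial_eq_invLap hu2 hu.radial he hr, hu.value_zero, zero_add]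
  refine invLap_congr hr fun s hs _ => ?_
  rw [radial_eq_invLap hv2 (laplacian_radial hu2 hu.radial) he hs, hu.laplacian_zero]
  simp only [hu.bilaplacian_eq]

/-! ### From the integral equation back to C⁴ solutions, in the variable t = r² -/

section Smoothing

variable {H H' : ℝ → ℝ}

/-- The weighted average `∫₀¹ ρᵖ H(t ρ²) dρ`. -/
def sqAverage (p : ℕ) (H : ℝ → ℝ) (t : ℝ) : ℝ := ∫ ρ in (0 : ℝ)..1, ρ ^ p * H (t * ρ ^ 2)

theorem continuous_sqAverage (p : ℕ) (hH : Continuous H) : Continuous (sqAverage p H) :=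
  intervalIntegral.continuous_parametric_intervalIntegral_of_continuous' (by fun_prop) 0 1

/-- Each derivative in t brings out a factor ρ², so these averages form a family closed under
differentiation. -/
theorem hasDerivAt_sqAverage (p : ℕ) (hH : ∀ t, HasDerivAt H (H' t) t) (hH' : Continuous H')
    (t : ℝ) : HasDerivAt (sqAverage p H) (sqAverage (p + 2) H' t) t := by
  have hHc : Continuous H := continuous_iff_continuousAt.2 fun r => (hH r).continuousAt
  obtain ⟨C, hC⟩ := (isCompact_closedBall (0 : ℝ) (|t| + 1)).exists_bound_of_continuousOn
    hH'.continuousOn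
  refine (intervalIntegral.hasDerivAt_integral_of_dominated_loc_of_deriv_le
    (F := fun t ρ => ρ ^ p * H (t * ρ ^ 2)) (F' := fun t ρ => ρ ^ (p + 2) * H' (t * ρ ^ 2))
    (s := Metric.ball t 1) (bound := fun _ => C) (μ := volume) (a := 0) (b := 1)
    (Metric.ball_mem_nhds t one_pos)
    (Eventually.of_forall fun x => (Continuous.aestronglyMeasurable (by fun_prop)))
    (Continuous.intervalIntegrable (by fun_prop) _ _)
    (Continuous.aestronglyMeasurable (by fun_prop)) (ae_of_all _ fun ρ hρ x hx => ?_) (by simp)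
    (ae_of_all _ fun ρ _ x _ => ?_)).2
  · rw [Set.uIoc_of_le zero_le_one] at hρ
    have h1 : |ρ ^ (p + 2)| ≤ 1 := by
      rw [abs_pow]; exact pow_le_one₀ (abs_nonneg _) (by rw [abs_of_pos hρ.1]; exact hρ.2)
    have h2 : ‖H' (x * ρ ^ 2)‖ ≤ C := by
      refine hC _ ?_
      rw [mem_closedBall_zero_iff, norm_mul, Real.norm_eq_abs, Real.norm_eq_abs]
      have h3 : |ρ ^ 2| ≤ 1 := by
        rw [abs_pow]; exact pow_le_one₀ (abs_nonneg _) (by rw [abs_of_pos hρ.1]; exact hρ.2)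
      have h4 : |x| ≤ |t| + 1 := by
        have := abs_add_le t (x - t)
        rw [Metric.mem_ball, Real.dist_eq] at hx
        simp only [add_sub_cancel] at this
        linarith
      nlinarith [abs_nonneg x, abs_nonneg (ρ ^ 2)]
    rw [norm_mul, Real.norm_eq_abs]
    nlinarith [norm_nonneg (H' (x * ρ ^ 2)), abs_nonneg (ρ ^ (p + 2))]
  · have := ((hH (x * ρ ^ 2)).comp x ((hasDerivAt_id x).mul_const (ρ ^ 2))).const_mul (ρ ^ p)
    refine this.congr_deriv ?_
    ring

theorem contDiff_sqAverage (n p : ℕ) (hH : ContDiff ℝ n H) : ContDiff ℝ n (sqAverage p H) := by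
  induction n generalizing p H with
  | zero => exact contDiff_zero.2 (continuous_sqAverage p hH.continuous)
  | succ n ih =>
    have hd : ContDiff ℝ (n + 1) H := by exact_mod_cast hH
    have h1 : ∀ t, HasDerivAt H (deriv H t) t := fun t =>
      (hd.differentiable (by simp) t).hasDerivAt
    have h2 : ContDiff ℝ n (deriv H) := (contDiff_succ_iff_deriv.1 hd).2.2
    have h3 := hasDerivAt_sqAverage p h1 h2.continuous
    have : ContDiff ℝ (n + 1) (sqAverage p H) := by
      refine contDiff_succ_iff_deriv.2 ⟨fun t => (h3 t).differentiableAt, by simp, ?_⟩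
      rw [show deriv (sqAverage p H) = sqAverage (p + 2) (deriv H) from
        funext fun t => (h3 t).deriv]
      exact ih _ h2
    exact_mod_cast this

/-- The inverse of the radial Laplacian of `ℝ³`, in the variable `t = r ^ 2`. -/
def sqInvLap (H : ℝ → ℝ) (t : ℝ) : ℝ := ∫ τ in (0 : ℝ)..t, sqAverage 2 H τ / 2

theorem hasDerivAt_sqInvLap (hH : Continuous H) (t : ℝ) :
    HasDerivAt (sqInvLap H) (sqAverage 2 H t / 2) t :=
  (((continuous_sqAverage 2 hH).div_const 2).integral_hasStrictDerivAt 0 t).hasDerivAt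

theorem contDiff_sqInvLap (n : ℕ) (hH : ContDiff ℝ n H) :
    ContDiff ℝ (n + 1) (sqInvLap H) := by
  refine contDiff_succ_iff_deriv.2
    ⟨fun t => (hasDerivAt_sqInvLap hH.continuous t).differentiableAt, by simp, ?_⟩
  rw [show deriv (sqInvLap H) = fun t => sqAverage 2 H t / 2 from
    funext fun t => (hasDerivAt_sqInvLap hH.continuous t).deriv]
  exact (contDiff_sqAverage n 2 hH).div_const 2

/-- Integrate the derivative of ρ³ H(t ρ²) over [0, 1]. The left side is the radial Laplacian 4 t
G'' + 6 G' of G = `sqInvLap H`. -/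
theorem sqAverage_add_sqAverage (hH : ∀ t, HasDerivAt H (H' t) t) (hH' : Continuous H') (t : ℝ) :
    3 * sqAverage 2 H t + 2 * t * sqAverage 4 H' t = H t := by
  have hHc : Continuous H := continuous_iff_continuousAt.2 fun r => (hH r).continuousAt
  have h := intervalIntegral.integral_eq_sub_of_hasDerivAt (a := 0) (b := 1)
    (f := fun ρ => ρ ^ 3 * H (t * ρ ^ 2))
    (f' := fun ρ => 3 * (ρ ^ 2 * H (t * ρ ^ 2)) + 2 * t * (ρ ^ 4 * H' (t * ρ ^ 2)))
    (fun ρ _ => ((hasDerivAt_pow 3 ρ).mul ((hH (t * ρ ^ 2)).comp ρ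
      ((hasDerivAt_pow 2 ρ).const_mul t))).congr_deriv (by
        simp only [Function.comp]; push_cast; ring))
    (Continuous.intervalIntegrable (by fun_prop) _ _)
  rw [intervalIntegral.integral_add (Continuous.intervalIntegrable (by fun_prop) _ _)
    (Continuous.intervalIntegrable (by fun_prop) _ _), intervalIntegral.integral_const_mul,
    intervalIntegral.integral_const_mul] at h
  simpa [sqAverage] using h

theorem laplacian_sqInvLap_norm_sq (hH : ContDiff ℝ 1 H) (c : ℝ) (x : E3) :
    Δ (fun y : E3 => c + sqInvLap H (‖y‖ ^ 2)) x = H (‖x‖ ^ 2) := by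
  have h1 : ∀ t, HasDerivAt H (deriv H t) t := fun t =>
      (hH.differentiable (by simp) t).hasDerivAt
  have h2 : Continuous (deriv H) := hH.continuous_deriv_one
  have := laplacian_comp_norm_sq x (G := fun t => c + sqInvLap H t)
    (Eventually.of_forall fun t => (hasDerivAt_sqInvLap hH.continuous t).const_add c)
    ((hasDerivAt_sqAverage 2 h1 h2 (‖x‖ ^ 2)).div_const 2)
  rw [this, ← sqAverage_add_sqAverage h1 h2]
  ring

/-- Both sides vanish at 0 and have the same derivative s⁻² ∫₀ˢ ρ² h(ρ) dρ; on the right this comes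
from an integration by parts. -/
theorem sqInvLap_sq (hH : Continuous H) {h : ℝ → ℝ} (hh : Continuous h)
    (hHh : ∀ s, 0 ≤ s → H (s ^ 2) = h s) {r : ℝ} (hr : 0 ≤ r) :
    sqInvLap H (r ^ 2) = invLap h r := by
  rcases hr.eq_or_lt with rfl | hr0
  · simp [sqInvLap]
  have hc : Continuous (sqInvLap H) :=
    continuous_iff_continuousAt.2 fun t => (hasDerivAt_sqInvLap hH t).continuousAt
  have key : ∀ s ∈ Set.Ioo 0 r,
      HasDerivAt (fun s => sqInvLap H (s ^ 2) - invLap h s) 0 s := by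
    intro s hs
    have hs0 := hs.1
    have hK : HasDerivAt (fun s => ∫ ρ in (0 : ℝ)..s, moment h ρ) (moment h s) s :=
      ((continuous_moment hh).integral_hasStrictDerivAt 0 s).hasDerivAt
    have hL : HasDerivAt (invLap h)
        ((moment h s * s - (∫ ρ in (0 : ℝ)..s, moment h ρ) * 1) / s ^ 2) s := by
      refine (hK.div (hasDerivAt_id s) hs0.ne').congr_of_eventuallyEq ?_
      filter_upwards [eventually_gt_nhds hs0] with t ht
      simp only [Pi.div_apply, id]
      rw [← mul_invLap]
      field_simp
    have hF := (hasDerivAt_sqInvLap hH (s ^ 2)).comp s (hasDerivAt_pow 2 s)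
    refine (hF.sub hL).congr_deriv ?_
    have e1 : s ^ 3 * sqAverage 2 H (s ^ 2) = ∫ ρ in (0 : ℝ)..s, ρ ^ 2 * h ρ := by
      have := intervalIntegral.mul_integral_comp_mul_left (a := 0) (b := 1)
        (f := fun ρ => ρ ^ 2 * h ρ) s
      rw [mul_zero, mul_one] at this
      rw [← this, pow_succ', mul_assoc, sqAverage, ← intervalIntegral.integral_const_mul]
      congr 1
      refine intervalIntegral.integral_congr fun ρ hρ => ?_
      rw [Set.uIcc_of_le zero_le_one] at hρ
      rw [← mul_pow, hHh _ (mul_nonneg hs0.le hρ.1)]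
      ring
    have e2 : s * moment h s - (∫ ρ in (0 : ℝ)..s, moment h ρ)
        = ∫ ρ in (0 : ℝ)..s, ρ ^ 2 * h ρ := by
      have := intervalIntegral.integral_mul_deriv_eq_deriv_mul (a := 0) (b := s)
        (u := fun ρ => ρ) (u' := fun _ => 1) (v := moment h) (v' := fun ρ => ρ * h ρ)
        (fun x _ => hasDerivAt_id x) (fun x _ => hasDerivAt_moment hh x)
        (by simp) (Continuous.intervalIntegrable (by fun_prop) _ _)
      simp only [one_mul, zero_mul, sub_zero] at this
      rw [← this]
      refine intervalIntegral.integral_congr fun ρ _ => ?_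
      ring
    rw [mul_one, mul_comm (moment h s), e2, ← e1]
    push_cast
    field_simp
    ring
  obtain ⟨c, hc1, hc2⟩ := exists_hasDerivAt_eq_slope _ _ hr0
    (Continuous.continuousOn ((hc.comp (continuous_pow 2)).sub (continuous_invLap hh))) key
  rw [eq_comm, div_eq_zero_iff] at hc2
  rcases hc2 with h | h
  · have h0 : sqInvLap H 0 = 0 := by simp [sqInvLap]
    simp [h0] at h
    linarith
  · linarith

end Smoothing

/-- Bootstrap in t: `H₀` is only continuous, but each inversion gains one derivative. Hence `G₁` is
C², `H₂ = exp ∘ G₁` is C², and a second pass through two inversions reaches C⁴. The functions agree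
with the profile for t ≥ 0, the only values taken by ‖x‖². -/
theorem IsProfile.exists_isEntireRadialSolution {β : ℝ} {g : ℝ → ℝ} (hg : IsProfile β g) :
    ∃ u : E3 → ℝ, IsEntireRadialSolution β u := by
  have hgc := hg.continuous
  have hvc : Continuous fun s => β + invLap (fun t => Real.exp (g t)) s :=
    continuous_const.add (continuous_invLap (by fun_prop))
  have step : ∀ H : ℝ → ℝ, Continuous H → (∀ s, 0 ≤ s → H (s ^ 2) = Real.exp (g s)) →
      ∀ r, 0 ≤ r → sqInvLap (fun t => β + sqInvLap H t) (r ^ 2) = g r := by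
    intro H hH hHg r hr
    have hc : Continuous (sqInvLap H) :=
      continuous_iff_continuousAt.2 fun t => (hasDerivAt_sqInvLap hH t).continuousAt
    rw [hg.eq r hr]
    refine sqInvLap_sq (by fun_prop) hvc (fun s hs => ?_) hr
    rw [sqInvLap_sq hH (by fun_prop) hHg hs]
  set H₀ : ℝ → ℝ := fun t => Real.exp (g (√t))
  have hH₀ : Continuous H₀ := by fun_prop
  set G₁ : ℝ → ℝ := sqInvLap fun t => β + sqInvLap H₀ t
  have hG₁ : ∀ r, 0 ≤ r → G₁ (r ^ 2) = g r := step H₀ hH₀ fun s hs => by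
    simp only [H₀, Real.sqrt_sq hs]
  have c0 : ContDiff ℝ ((0 : ℕ) : WithTop ℕ∞) H₀ := contDiff_zero.2 hH₀
  have c1 : ContDiff ℝ ((1 : ℕ) : WithTop ℕ∞) fun t => β + sqInvLap H₀ t :=
    contDiff_const.add (by simpa using contDiff_sqInvLap 0 c0)
  have c2 : ContDiff ℝ ((2 : ℕ) : WithTop ℕ∞) G₁ := by
    simpa [one_add_one_eq_two] using contDiff_sqInvLap 1 c1
  set H₂ : ℝ → ℝ := fun t => Real.exp (G₁ t)
  have c2' : ContDiff ℝ ((2 : ℕ) : WithTop ℕ∞) H₂ := c2.exp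
  set V : ℝ → ℝ := fun t => β + sqInvLap H₂ t
  have c3 : ContDiff ℝ ((3 : ℕ) : WithTop ℕ∞) V := by
    refine contDiff_const.add ?_
    have := contDiff_sqInvLap 2 c2'
    exact_mod_cast this
  have c4 : ContDiff ℝ 4 (sqInvLap V) := by
    have := contDiff_sqInvLap 3 c3
    exact_mod_cast this
  have hG₂ : ∀ r, 0 ≤ r → sqInvLap V (r ^ 2) = g r := step H₂ c2'.continuous fun s hs => by
    simp only [H₂, hG₁ s hs]
  have l1 : Δ (fun x : E3 => sqInvLap V (‖x‖ ^ 2)) = fun x : E3 => V (‖x‖ ^ 2) := by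
    funext x
    have := laplacian_sqInvLap_norm_sq (c3.of_le (by norm_num)) 0 x
    simpa using this
  refine ⟨fun x => sqInvLap V (‖x‖ ^ 2), c4.comp (contDiff_norm_sq ℝ), fun x y h => by
    simp only [h], fun x => ?_, by simp [sqInvLap], ?_⟩
  · rw [l1, laplacian_sqInvLap_norm_sq (c2'.of_le (by norm_num))]
    simp only [H₂, hG₂ _ (norm_nonneg x), hG₁ _ (norm_nonneg x)]
  · rw [l1]; simp [V, sqInvLap]

/-! ### Monotone iteration and admissible parameters -/

/-- Picard iterates for `exp` of the profile, increasing from the zero function. -/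
def expIter (β : ℝ) : ℕ → ℝ → ℝ
  | 0 => fun _ => 0
  | n + 1 => fun r => Real.exp (invLap (fun s => β + invLap (expIter β n) s) r)

/-- All the Picard iterates are at most one on the half-line. -/
def IsAdmissible (β : ℝ) : Prop := ∀ n r, 0 ≤ r → expIter β n r ≤ 1

section Iteration

variable {β γ : ℝ}

theorem continuous_moment_param {X : Type*} [TopologicalSpace X] [FirstCountableTopology X]
    [LocallyCompactSpace X] {f : X → ℝ → ℝ}
    (hf : Continuous fun p : X × ℝ => f p.1 p.2) :
    Continuous fun p : X × ℝ => moment (f p.1) p.2 :=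
  intervalIntegral.continuous_parametric_intervalIntegral_of_continuous
    (f := fun (p : X × ℝ) s => s * f p.1 s)
    (continuous_snd.mul (hf.comp (f := fun q : (X × ℝ) × ℝ => (q.1.1, q.2)) (by fun_prop)))
    continuous_snd

theorem continuous_invLap_param {X : Type*} [TopologicalSpace X] [FirstCountableTopology X]
    [LocallyCompactSpace X] {f : X → ℝ → ℝ}
    (hf : Continuous fun p : X × ℝ => f p.1 p.2) :
    Continuous fun p : X × ℝ => invLap (f p.1) p.2 :=
  intervalIntegral.continuous_parametric_intervalIntegral_of_continuous'
    (f := fun (p : X × ℝ) θ => moment (f p.1) (p.2 * θ))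
    ((continuous_moment_param hf).comp
      (f := fun q : (X × ℝ) × ℝ => (q.1.1, q.1.2 * q.2)) (by fun_prop)) 0 1

theorem continuous_expIter_param (n : ℕ) :
    Continuous fun p : ℝ × ℝ => expIter p.1 n p.2 := by
  induction n with
  | zero => exact continuous_const
  | succ n ih =>
    exact Real.continuous_exp.comp (continuous_invLap_param
      (f := fun β s => β + invLap (expIter β n) s)
      (continuous_fst.add (continuous_invLap_param (f := fun β => expIter β n) ih)))

theorem continuous_expIter (β : ℝ) (n : ℕ) : Continuous (expIter β n) :=
  (continuous_expIter_param n).comp (f := fun r => (β, r)) (by fun_prop)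

theorem expIter_nonneg (β : ℝ) (n : ℕ) (r : ℝ) : 0 ≤ expIter β n r := by
  cases n
  · exact le_rfl
  · exact (Real.exp_pos _).le

theorem invLap_invLap_mono {h k : ℝ → ℝ} (hβ : β ≤ γ) {r : ℝ} (hr : 0 ≤ r) (hh : Continuous h)
    (hk : Continuous k) (H : ∀ s, 0 ≤ s → s ≤ r → h s ≤ k s) :
    invLap (fun s => β + invLap h s) r ≤ invLap (fun s => γ + invLap k s) r := by
  have h1 := continuous_invLap hh
  have h2 := continuous_invLap hk
  exact invLap_mono hr (by fun_prop) (by fun_prop) fun s hs hsr =>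
    add_le_add hβ (invLap_mono hs hh hk fun t ht hts => H t ht (hts.trans hsr))

theorem expIter_mono (hβ : β ≤ γ) (n : ℕ) {r : ℝ} (hr : 0 ≤ r) :
    expIter β n r ≤ expIter γ n r := by
  induction n generalizing r with
  | zero => exact le_rfl
  | succ n ih =>
    exact Real.exp_le_exp.2 (invLap_invLap_mono hβ hr (continuous_expIter _ _)
      (continuous_expIter _ _) fun s hs _ => ih hs)

theorem expIter_le_succ (β : ℝ) (n : ℕ) {r : ℝ} (hr : 0 ≤ r) :
    expIter β n r ≤ expIter β (n + 1) r := by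
  induction n generalizing r with
  | zero => exact expIter_nonneg _ _ _
  | succ n ih =>
    exact Real.exp_le_exp.2 (invLap_invLap_mono le_rfl hr (continuous_expIter _ _)
      (continuous_expIter _ _) fun s hs _ => ih hs)

theorem IsProfile.expIter_le {g : ℝ → ℝ} (hg : IsProfile β g) (n : ℕ) {r : ℝ} (hr : 0 ≤ r) :
    expIter β n r ≤ Real.exp (g r) := by
  have := hg.continuous
  induction n generalizing r with
  | zero => exact (Real.exp_pos _).le
  | succ n ih =>
    rw [hg.eq r hr]
    exact Real.exp_le_exp.2 (invLap_invLap_mono le_rfl hr (continuous_expIter _ _)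
      (by fun_prop) fun s hs _ => ih hs)

theorem IsAdmissible.mono (h : IsAdmissible γ) (hβ : β ≤ γ) : IsAdmissible β :=
  fun n r hr => (expIter_mono hβ n hr).trans (h n r hr)

/-- For fixed n and r the condition is closed because the iterate is continuous in β. -/
theorem isClosed_isAdmissible : IsClosed {β | IsAdmissible β} := by
  simp only [IsAdmissible, Set.ofPred_forall]
  refine isClosed_iInter fun n => isClosed_iInter fun r => isClosed_iInter fun _ => ?_
  exact isClosed_le ((continuous_expIter_param n).comp (f := fun β => (β, r)) (by fun_prop))
    continuous_const

theorem moment_gaussian {a : ℝ} (ha : a ≠ 0) (r : ℝ) :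
    moment (fun s => Real.exp (-a * s ^ 2)) r = (1 - Real.exp (-a * r ^ 2)) / (2 * a) := by
  have := intervalIntegral.integral_eq_sub_of_hasDerivAt (a := 0) (b := r)
    (f := fun s => -Real.exp (-a * s ^ 2) / (2 * a)) (f' := fun s => s * Real.exp (-a * s ^ 2))
    (fun s _ => ((((hasDerivAt_pow 2 s).const_mul (-a)).exp.neg).div_const (2 * a)).congr_deriv
      (by push_cast; field_simp))
    (Continuous.intervalIntegrable (by fun_prop) _ _)
  rw [moment, this]
  simp
  field_simp
  ring

/-- The bound e^(-r²) reproduces itself: its weighted primitive is at most 1/2, and (-7 + 1/2) r² /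
6 ≤ -r². -/
theorem isAdmissible_neg_seven : IsAdmissible (-7) := by
  have key : ∀ n r, 0 ≤ r → expIter (-7) n r ≤ Real.exp (-1 * r ^ 2) := by
    intro n
    induction n with
    | zero => exact fun r _ => (Real.exp_pos _).le
    | succ n ih =>
      intro r hr
      refine Real.exp_le_exp.2 ?_
      have h1 := invLap_add_invLap_le (continuous_expIter (-7) n)
        (fun s _ => expIter_nonneg (-7) n s) (-7) hr
      have h2 := moment_mono hr (continuous_expIter (-7) n)
        (k := fun s => Real.exp (-1 * s ^ 2)) (by fun_prop) fun s hs _ => ih s hs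
      rw [moment_gaussian one_ne_zero] at h2
      have h3 := Real.exp_pos (-1 * r ^ 2)
      nlinarith [sq_nonneg r]
  intro n r hr
  refine (key n r hr).trans (Real.exp_le_one_iff.2 ?_)
  nlinarith [sq_nonneg r]

theorem tendsto_moment {F : ℕ → ℝ → ℝ} {f : ℝ → ℝ} {r C : ℝ} (hr : 0 ≤ r)
    (hF : ∀ n, Continuous (F n)) (hC : ∀ n s, 0 ≤ s → s ≤ r → |F n s| ≤ C)
    (hlim : ∀ s, 0 ≤ s → s ≤ r → Tendsto (fun n => F n s) atTop (𝓝 (f s))) :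
    Tendsto (fun n => moment (F n) r) atTop (𝓝 (moment f r)) := by
  refine intervalIntegral.tendsto_integral_filter_of_dominated_convergence (fun s => |s| * C)
    (Eventually.of_forall fun n => (continuous_id.mul (hF n)).aestronglyMeasurable)
    (Eventually.of_forall fun n => ae_of_all _ fun s hs => ?_)
    (Continuous.intervalIntegrable (by fun_prop) _ _) (ae_of_all _ fun s hs => ?_)
  all_goals rw [Set.uIoc_of_le hr] at hs
  · rw [norm_mul]
    exact mul_le_mul_of_nonneg_left (hC n s hs.1.le hs.2) (norm_nonneg _)
  · exact (hlim s hs.1.le hs.2).const_mul s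

theorem tendsto_invLap {F : ℕ → ℝ → ℝ} {f : ℝ → ℝ} {r C : ℝ} (hr : 0 ≤ r)
    (hF : ∀ n, Continuous (F n)) (hC : ∀ n s, 0 ≤ s → s ≤ r → |F n s| ≤ C)
    (hlim : ∀ s, 0 ≤ s → s ≤ r → Tendsto (fun n => F n s) atTop (𝓝 (f s))) :
    Tendsto (fun n => invLap (F n) r) atTop (𝓝 (invLap f r)) := by
  have hC0 : 0 ≤ C := (abs_nonneg _).trans (hC 0 0 le_rfl hr)
  refine intervalIntegral.tendsto_integral_filter_of_dominated_convergence (fun _ => r * C * r)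
    (Eventually.of_forall fun n => Continuous.aestronglyMeasurable
      ((continuous_moment (hF n)).comp (by fun_prop)))
    (Eventually.of_forall fun n => ae_of_all _ fun θ hθ => ?_) (by simp)
    (ae_of_all _ fun θ hθ => ?_)
  all_goals
    rw [Set.uIoc_of_le zero_le_one] at hθ
    have h1 : 0 ≤ r * θ := mul_nonneg hr hθ.1.le
    have h2 : r * θ ≤ r := mul_le_of_le_one_right hr hθ.2
  · have := intervalIntegral.norm_integral_le_of_norm_le_const (a := 0) (b := r * θ) (C := r * C)
      (f := fun s => s * F n s) fun s hs => by
        rw [Set.uIoc_of_le h1] at hs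
        rw [norm_mul, Real.norm_eq_abs, Real.norm_eq_abs, abs_of_pos hs.1]
        exact mul_le_mul (hs.2.trans h2) (hC n s hs.1.le (hs.2.trans h2)) (abs_nonneg _) hr
    refine this.trans ?_
    rw [sub_zero, abs_of_nonneg h1]
    exact mul_le_mul_of_nonneg_left h2 (by positivity)
  · exact tendsto_moment h1 hF (fun n s hs hs' => hC n s hs (hs'.trans h2))
      fun s hs hs' => hlim s hs (hs'.trans h2)

theorem IsAdmissible.exists_isProfile (hβ : IsAdmissible β) : ∃ g, IsProfile β g := by
  -- The absolute value makes the supremum bounded on all of ℝ, since admissibility controls only r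
  -- ≥ 0.
  set f : ℝ → ℝ := fun r => ⨆ n, expIter β n |r| with hf
  have hbdd : ∀ r, BddAbove (Set.range fun n => expIter β n |r|) := fun r =>
    ⟨1, by rintro _ ⟨n, rfl⟩; exact hβ n _ (abs_nonneg r)⟩
  have hlim : ∀ r, 0 ≤ r → Tendsto (fun n => expIter β n r) atTop (𝓝 (f r)) := by
    intro r hr
    have := tendsto_atTop_ciSup
      (monotone_nat_of_le_succ fun n => expIter_le_succ β n (abs_nonneg r)) (hbdd r)
    simp only [hf, abs_of_nonneg hr] at this ⊢
    exact this
  have hmeas : Measurable f := Measurable.iSup fun n =>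
    ((continuous_expIter β n).comp continuous_abs).measurable
  have hf0 : ∀ r, 0 ≤ f r := fun r => Real.iSup_nonneg fun n => expIter_nonneg _ _ _
  have hf1 : ∀ r, f r ≤ 1 := fun r => ciSup_le fun n => hβ n _ (abs_nonneg r)
  have hmc : Continuous (moment f) := by
    refine intervalIntegral.continuous_primitive (fun a b => ?_) 0
    refine IntervalIntegrable.mono_fun (continuous_id.intervalIntegrable a b)
      (measurable_id.mul hmeas).aestronglyMeasurable (ae_of_all _ fun s => ?_)
    simp only [norm_mul, id]
    rw [Real.norm_eq_abs (f s), abs_of_nonneg (hf0 s)]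
    exact mul_le_of_le_one_right (norm_nonneg _) (hf1 s)
  have hLc := continuous_invLap_of_moment hmc
  set g : ℝ → ℝ := fun r => invLap (fun s => β + invLap f s) r with hg
  have hgc : Continuous g := continuous_invLap (by fun_prop)
  have habs : ∀ n s, 0 ≤ s → |expIter β n s| ≤ 1 := fun n s hs => by
    rw [abs_of_nonneg (expIter_nonneg _ _ _)]; exact hβ n s hs
  -- Dominated convergence, applied to both nested inversions, passes the recursion to the limit.
  have hfg : ∀ r, 0 ≤ r → f r = Real.exp (g r) := by
    intro r hr
    refine tendsto_nhds_unique ((tendsto_add_atTop_iff_nat 1).2 (hlim r hr)) ?_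
    refine (Real.continuous_exp.tendsto _).comp ?_
    refine tendsto_invLap (C := |β| + r ^ 2 / 6) hr
      (fun n => continuous_const.add (continuous_invLap (continuous_expIter β n)))
      (fun n s hs hsr => ?_) fun s hs hsr => ?_
    · refine (abs_add_le _ _).trans (add_le_add le_rfl ?_)
      rw [abs_of_nonneg (invLap_nonneg (fun t _ => expIter_nonneg _ _ _) hs)]
      have := invLap_mono hs (continuous_expIter β n) (k := fun _ => 1) continuous_const
        fun t ht _ => hβ n t ht
      rw [invLap_const] at this
      nlinarith
    · exact (tendsto_invLap hs (continuous_expIter β) (fun n t ht _ => habs n t ht)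
        fun t ht _ => hlim t ht).const_add β
  refine ⟨g, hgc, fun r hr => ?_⟩
  refine invLap_congr hr fun s hs _ => ?_
  rw [invLap_congr hs fun t ht _ => hfg t ht]

end Iteration

/-! ### Blow-up for y'''' = r exp(y / r) -/

section BlowUp

theorem le_of_hasDerivAt_nonneg {f f' : ℝ → ℝ} {a b : ℝ} (hab : a ≤ b)
    (hd : ∀ x, a ≤ x → x ≤ b → HasDerivAt f (f' x) x) (hf' : ∀ x, a < x → x < b → 0 ≤ f' x) :
    f a ≤ f b := by
  rcases hab.eq_or_lt with rfl | h
  · exact le_rfl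
  obtain ⟨c, hc, hc'⟩ := exists_hasDerivAt_eq_slope f f' h
    (fun x hx => (hd x hx.1 hx.2).continuousAt.continuousWithinAt)
    (fun x hx => hd x hx.1.le hx.2.le)
  have h1 := hf' c hc.1 hc.2
  rw [hc', le_div_iff₀ (sub_pos.2 h)] at h1
  linarith

/-- Integrating a lower bound by a power. -/
theorem eventually_pow_succ_le {f f' : ℝ → ℝ} (hd : ∀ x, 0 < x → HasDerivAt f (f' x) x) {k : ℕ}
    (h : ∃ a > 0, ∀ᶠ r in atTop, a * r ^ k ≤ f' r) :
    ∃ b > 0, ∀ᶠ r in atTop, b * r ^ (k + 1) ≤ f r := by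
  obtain ⟨a, ha, hev⟩ := h
  obtain ⟨R, hR⟩ := eventually_atTop.1 (hev.and (eventually_gt_atTop 0))
  set c : ℝ := a / (k + 1)
  have hc : 0 < c := by positivity
  -- Half of the coefficient is given up to absorb the constant of integration at `R`.
  refine ⟨c / 2, by positivity, ?_⟩
  have hlim : Tendsto (fun r : ℝ => c / 2 * r ^ (k + 1)) atTop atTop :=
    (tendsto_pow_atTop (by omega)).const_mul_atTop (by positivity)
  filter_upwards [hlim.eventually_ge_atTop (c * R ^ (k + 1) - f R), eventually_ge_atTop R]
    with r hr hRr
  have := le_of_hasDerivAt_nonneg hRr (f := fun x => f x - c * x ^ (k + 1))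
    (f' := fun x => f' x - a * x ^ k)
    (fun x hx _ => ((hd x (hR x hx).2).sub ((hasDerivAt_pow (k + 1) x).const_mul c)).congr_deriv
      (by simp only [c]; push_cast; field_simp))
    (fun x hx _ => sub_nonneg.2 (hR x hx.le).1)
  linarith

theorem eventually_sq_lt {f : ℝ → ℝ} {k : ℕ} (hk : 2 < k)
    (h : ∃ b > 0, ∀ᶠ r in atTop, b * r ^ k ≤ f r) : ∀ᶠ r in atTop, 6 * r ^ 2 < f r := by
  obtain ⟨b, hb, hev⟩ := h
  have hlim : Tendsto (fun r : ℝ => b * r ^ (k - 2)) atTop atTop :=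
    (tendsto_pow_atTop (by omega)).const_mul_atTop hb
  filter_upwards [hev, hlim.eventually_gt_atTop 6, eventually_gt_atTop 0] with r h1 h2 h3
  refine lt_of_lt_of_le ?_ h1
  rw [show k = (k - 2) + 2 by omega, pow_add, ← mul_assoc]
  exact mul_lt_mul_of_pos_right h2 (by positivity)

/-- A solution of `y'''' = r exp (y / r)` with large data at `r₁` stays above `r₁² / (r₁ + 1 - r)`,
so it cannot exist up to `r₁ + 1`. -/
theorem not_large_data {y₀ y₁ y₂ y₃ : ℝ → ℝ} (d₀ : ∀ r, 0 < r → HasDerivAt y₀ (y₁ r) r)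
    (d₁ : ∀ r, 0 < r → HasDerivAt y₁ (y₂ r) r) (d₂ : ∀ r, 0 < r → HasDerivAt y₂ (y₃ r) r)
    (d₃ : ∀ r, 0 < r → HasDerivAt y₃ (r * Real.exp (y₀ r / r)) r) {r₁ : ℝ} (hr₁ : 20 ≤ r₁)
    (h₀ : r₁ ^ 2 < y₀ r₁) (h₁ : r₁ ^ 2 < y₁ r₁) (h₂ : 2 * r₁ ^ 2 < y₂ r₁)
    (h₃ : 6 * r₁ ^ 2 < y₃ r₁) : False := by
  set K := r₁ ^ 2 with hK
  have hKpos : 0 < K := by positivity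
  set T := r₁ + 1 with hT
  have hr₁0 : 0 < r₁ := by linarith
  have hτ : ∀ r, r < T → HasDerivAt (fun r => (T - r)⁻¹) ((T - r)⁻¹ ^ 2) r := by
    intro r hr
    have hne : T - r ≠ 0 := by linarith
    refine (((hasDerivAt_id r).const_sub T).inv hne).congr_deriv ?_
    simp only [id]
    field_simp
  have e₀ : ∀ r, r < T → HasDerivAt (fun r => K * (T - r)⁻¹) (K * (T - r)⁻¹ ^ 2) r :=
    fun r hr => (hτ r hr).const_mul K
  have e₁ : ∀ r, r < T →
      HasDerivAt (fun r => K * (T - r)⁻¹ ^ 2) (2 * K * (T - r)⁻¹ ^ 3) r :=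
    fun r hr => (((hτ r hr).pow 2).const_mul K).congr_deriv (by push_cast; ring)
  have e₂ : ∀ r, r < T →
      HasDerivAt (fun r => 2 * K * (T - r)⁻¹ ^ 3) (6 * K * (T - r)⁻¹ ^ 4) r :=
    fun r hr => (((hτ r hr).pow 3).const_mul (2 * K)).congr_deriv (by push_cast; ring)
  have e₃ : ∀ r, r < T →
      HasDerivAt (fun r => 6 * K * (T - r)⁻¹ ^ 4) (24 * K * (T - r)⁻¹ ^ 5) r :=
    fun r hr => (((hτ r hr).pow 4).const_mul (6 * K)).congr_deriv (by push_cast; ring)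
  have hT1 : (T - r₁)⁻¹ = 1 := by simp [hT]
  -- The barrier K / (T - r) is a subsolution: r ≤ 2 r₁ bounds y₀ / r below by r₁ τ / 2, and the
  -- quintic term of the exponential suffices because 24 · 3840 ≤ 20⁴ ≤ r₁⁴.
  have sub : ∀ r, r₁ ≤ r → r < T → K * (T - r)⁻¹ ≤ y₀ r →
      24 * K * (T - r)⁻¹ ^ 5 ≤ r * Real.exp (y₀ r / r) := by
    intro r hr hrT hy
    have hr0 : 0 < r := by linarith
    set τ := (T - r)⁻¹ with hτdef
    have hτ1 : 0 < τ := inv_pos.2 (by linarith)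
    have hx : r₁ * τ / 2 ≤ y₀ r / r := by
      rw [le_div_iff₀ hr0]
      refine le_trans ?_ hy
      rw [hK]
      have : r ≤ 2 * r₁ := by linarith
      nlinarith [mul_pos hr₁0 hτ1]
    have h5 := Real.pow_div_factorial_le_exp (r₁ * τ / 2) (by positivity) 5
    have h6 : 24 * K * τ ^ 5 ≤ r₁ * ((r₁ * τ / 2) ^ 5 / (5).factorial) := by
      have : (20 : ℝ) ^ 4 ≤ r₁ ^ 4 := by gcongr
      norm_num [Nat.factorial]
      have h7 : 0 < K * τ ^ 5 := by positivity
      have : r₁ * ((r₁ * τ / 2) ^ 5 / 120) = r₁ ^ 4 * (K * τ ^ 5) / 3840 := by rw [hK]; ring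
      rw [this]
      nlinarith
    calc 24 * K * τ ^ 5 ≤ r₁ * ((r₁ * τ / 2) ^ 5 / (5).factorial) := h6
      _ ≤ r₁ * Real.exp (r₁ * τ / 2) := by gcongr
      _ ≤ r * Real.exp (y₀ r / r) := by gcongr
  have key : ∀ x, r₁ ≤ x → x < T → K * (T - x)⁻¹ < y₀ x := by
    intro x hx hxT
    by_contra hcon
    push Not at hcon
    have hcont : ContinuousOn (fun r => y₀ r - K * (T - r)⁻¹) (Set.Icc r₁ x) := fun r hr =>
      ((d₀ r (hr₁0.trans_le hr.1)).sub
        (e₀ r (hr.2.trans_lt hxT))).continuousAt.continuousWithinAt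
    have hcpt : IsCompact (Set.Icc r₁ x ∩ (fun r => y₀ r - K * (T - r)⁻¹) ⁻¹' Set.Iic 0) :=
      isCompact_Icc.of_isClosed_subset (hcont.preimage_isClosed_of_isClosed isClosed_Icc
        isClosed_Iic) Set.inter_subset_left
    -- `m` is the first point where y₀ fails to exceed the barrier. Before it the fourth derivatives
    -- are ordered, and four integrations from the strictly ordered data at r₁ give a contradiction
    -- at `m`.
    obtain ⟨m, ⟨⟨hm1, hmx⟩, hm0⟩, hmin⟩ := hcpt.exists_isLeast
      ⟨x, ⟨hx, le_rfl⟩, by simpa using hcon⟩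
    have hmT := hmx.trans_lt hxT
    have hpos : ∀ r, r₁ ≤ r → r < m → K * (T - r)⁻¹ ≤ y₀ r := by
      intro r hr hrm
      by_contra hlt
      push Not at hlt
      exact absurd (hmin ⟨⟨hr, hrm.le.trans hmx⟩, by simpa using hlt.le⟩) (not_le.2 hrm)
    have m₃ : ∀ r, r₁ ≤ r → r ≤ m → 0 ≤ y₃ r - 6 * K * (T - r)⁻¹ ^ 4 := by
      intro r hr hrm
      have := le_of_hasDerivAt_nonneg hr (f := fun r => y₃ r - 6 * K * (T - r)⁻¹ ^ 4)
        (fun s hs hs' => (d₃ s (hr₁0.trans_le hs)).sub (e₃ s (by linarith)))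
        fun s hs hs' => sub_nonneg.2 (sub s hs.le (by linarith) (hpos s hs.le (by linarith)))
      simp only [hT1, one_pow, mul_one] at this
      linarith
    have m₂ : ∀ r, r₁ ≤ r → r ≤ m → 0 ≤ y₂ r - 2 * K * (T - r)⁻¹ ^ 3 := by
      intro r hr hrm
      have := le_of_hasDerivAt_nonneg hr (f := fun r => y₂ r - 2 * K * (T - r)⁻¹ ^ 3)
        (fun s hs hs' => (d₂ s (hr₁0.trans_le hs)).sub (e₂ s (by linarith)))
        fun s hs hs' => m₃ s hs.le (by linarith)
      simp only [hT1, one_pow, mul_one] at this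
      linarith
    have m₁ : ∀ r, r₁ ≤ r → r ≤ m → 0 ≤ y₁ r - K * (T - r)⁻¹ ^ 2 := by
      intro r hr hrm
      have := le_of_hasDerivAt_nonneg hr (f := fun r => y₁ r - K * (T - r)⁻¹ ^ 2)
        (fun s hs hs' => (d₁ s (hr₁0.trans_le hs)).sub (e₁ s (by linarith)))
        fun s hs hs' => m₂ s hs.le (by linarith)
      simp only [hT1, one_pow, mul_one] at this
      linarith
    have m₀ := le_of_hasDerivAt_nonneg hm1 (f := fun r => y₀ r - K * (T - r)⁻¹)
        (fun s hs hs' => (d₀ s (hr₁0.trans_le hs)).sub (e₀ s (by linarith)))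
        fun s hs hs' => m₁ s hs.le (by linarith)
    simp only [hT1, mul_one] at m₀
    have : y₀ m - K * (T - m)⁻¹ ≤ 0 := hm0
    linarith
  obtain ⟨C, hC⟩ := isCompact_Icc.exists_bound_of_continuousOn (s := Set.Icc r₁ T) (f := y₀)
    fun r hr => (d₀ r (hr₁0.trans_le hr.1)).continuousAt.continuousWithinAt
  have hden : 0 < |C| + K := by positivity
  have hfrac : K / (|C| + K) ≤ 1 := (div_le_one hden).2 (by linarith [abs_nonneg C])
  have hfrac0 : 0 < K / (|C| + K) := by positivity
  -- At this point the barrier equals |C| + K, above the bound for y₀ on [r₁, T].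
  have h4 := key (T - K / (|C| + K)) (by linarith) (by linarith)
  have h5 := hC (T - K / (|C| + K)) ⟨by linarith, by linarith⟩
  rw [sub_sub_cancel, inv_div, mul_div_cancel₀ _ hKpos.ne'] at h4
  have h6 := le_abs_self (y₀ (T - K / (|C| + K)))
  rw [Real.norm_eq_abs] at h5
  linarith [le_abs_self C]

/-- A positive y₃ stays bounded below, so y₀ grows at least like r³. Then the exponential makes the
fourth derivative at least of order r⁵, and integrating again pushes all four functions past 6 r²,
the data required by `not_large_data`. -/
theorem third_deriv_nonpos {y₀ y₁ y₂ y₃ : ℝ → ℝ} (d₀ : ∀ r, 0 < r → HasDerivAt y₀ (y₁ r) r)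
    (d₁ : ∀ r, 0 < r → HasDerivAt y₁ (y₂ r) r) (d₂ : ∀ r, 0 < r → HasDerivAt y₂ (y₃ r) r)
    (d₃ : ∀ r, 0 < r → HasDerivAt y₃ (r * Real.exp (y₀ r / r)) r) {r₀ : ℝ} (hr₀ : 0 < r₀) :
    y₃ r₀ ≤ 0 := by
  by_contra hpos
  push Not at hpos
  have p₃ : ∃ a > 0, ∀ᶠ r in atTop, a * r ^ 0 ≤ y₃ r := by
    refine ⟨y₃ r₀, hpos, ?_⟩
    filter_upwards [eventually_ge_atTop r₀] with r hr
    rw [pow_zero, mul_one]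
    exact le_of_hasDerivAt_nonneg hr (fun s hs _ => d₃ s (hr₀.trans_le hs)) fun s hs _ =>
      mul_nonneg (hr₀.trans hs).le (Real.exp_pos _).le
  obtain ⟨b, hb, hy⟩ := eventually_pow_succ_le d₀ (eventually_pow_succ_le d₁
    (eventually_pow_succ_le d₂ p₃))
  have p₄ : ∃ a > 0, ∀ᶠ r in atTop, a * r ^ 5 ≤ r * Real.exp (y₀ r / r) := by
    refine ⟨b ^ 2 / 2, by positivity, ?_⟩
    filter_upwards [hy, eventually_gt_atTop 0] with r h1 h2
    have h3 : b * r ^ 2 ≤ y₀ r / r := by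
      have h1' : b * r ^ 3 ≤ y₀ r := h1
      rw [le_div_iff₀ h2]; linarith
    have h4 := Real.pow_div_factorial_le_exp (b * r ^ 2) (by positivity) 2
    calc b ^ 2 / 2 * r ^ 5 = r * ((b * r ^ 2) ^ 2 / (2).factorial) := by
          norm_num [Nat.factorial]; ring
      _ ≤ r * Real.exp (b * r ^ 2) := by gcongr
      _ ≤ r * Real.exp (y₀ r / r) := by gcongr
  have q₃ := eventually_pow_succ_le d₃ p₄
  have q₂ := eventually_pow_succ_le d₂ q₃
  have q₁ := eventually_pow_succ_le d₁ q₂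
  have q₀ := eventually_pow_succ_le d₀ q₁
  obtain ⟨r, h3, h2, h1, h0, hr⟩ := ((eventually_sq_lt (by norm_num) q₃).and
    ((eventually_sq_lt (by norm_num) q₂).and ((eventually_sq_lt (by norm_num) q₁).and
    ((eventually_sq_lt (by norm_num) q₀).and (eventually_ge_atTop 20))))).exists
  have := sq_nonneg r
  exact not_large_data d₀ d₁ d₂ d₃ hr (by linarith) (by linarith) (by linarith) h3

end BlowUp

/-! ### Sign of the third derivative and the existence criterion -/

section Profile

variable {β : ℝ} {g : ℝ → ℝ}

/-- The first-order system satisfied by `r ↦ r g(r)`. -/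
theorem IsProfile.exists_system (hg : IsProfile β g) : ∃ y₀ y₁ y₂ : ℝ → ℝ,
    (∀ r, HasDerivAt y₀ (y₁ r) r) ∧ (∀ r, HasDerivAt y₁ (y₂ r) r) ∧
    (∀ r, HasDerivAt y₂ (β + moment (fun t => Real.exp (g t)) r) r) ∧
    y₀ 0 = 0 ∧ y₁ 0 = 0 ∧ y₂ 0 = 0 ∧ ∀ r, 0 ≤ r → y₀ r = r * g r := by
  have hgc := hg.continuous
  set k : ℝ → ℝ := fun t => Real.exp (g t) with hk
  have hkc : Continuous k := by fun_prop
  have hm := continuous_moment hkc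
  set v : ℝ → ℝ := fun s => β + invLap k s with hv
  have hvc : Continuous v := continuous_const.add (continuous_invLap hkc)
  have h2 : ∀ s, s * v s = ∫ t in (0 : ℝ)..s, (β + moment k t) := by
    intro s
    rw [intervalIntegral.integral_add (by simp) (hm.intervalIntegrable _ _), ← mul_invLap]
    simp [hv]
    ring
  refine ⟨fun r => r * invLap v r, moment v, fun r => r * v r, fun r => ?_, hasDerivAt_moment hvc,
    fun r => ?_, by simp, by simp, by simp, fun r hr => by rw [hg.eq r hr]⟩
  · simp only [mul_invLap]
    exact ((continuous_moment hvc).integral_hasStrictDerivAt 0 r).hasDerivAt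
  · simp only [h2]
    exact ((continuous_const.add hm).integral_hasStrictDerivAt 0 r).hasDerivAt

theorem IsProfile.exp_continuous (hg : IsProfile β g) : Continuous fun t => Real.exp (g t) :=
  Real.continuous_exp.comp hg.continuous

theorem IsProfile.add_moment_mono (hg : IsProfile β g) {r t : ℝ} (hr : 0 ≤ r) (hrt : r ≤ t) :
    β + moment (fun t => Real.exp (g t)) r ≤ β + moment (fun t => Real.exp (g t)) t := by
  have := moment_le_moment hg.exp_continuous (fun s _ => (Real.exp_pos _).le) hr hrt
  linarith

/-- The quantity is the third derivative of r g. Evaluating at r + 1 keeps away from the origin, and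
monotonicity brings the bound back to r. -/
theorem IsProfile.add_moment_nonpos (hg : IsProfile β g) {r : ℝ} (hr : 0 ≤ r) :
    β + moment (fun t => Real.exp (g t)) r ≤ 0 := by
  obtain ⟨y₀, y₁, y₂, d₀, d₁, d₂, -, -, -, h⟩ := hg.exists_system
  refine (hg.add_moment_mono hr (show r ≤ r + 1 by linarith)).trans ?_
  refine third_deriv_nonpos (y₃ := fun r => β + moment (fun t => Real.exp (g t)) r)
    (fun r _ => d₀ r) (fun r _ => d₁ r) (fun r _ => d₂ r) (fun s hs => ?_)
    (show 0 < r + 1 by linarith)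
  rw [h s hs.le, mul_div_cancel_left₀ _ hs.ne']
  exact (hasDerivAt_moment hg.exp_continuous s).const_add β

theorem IsProfile.add_moment_neg (hg : IsProfile β g) {r : ℝ} (hr : 0 ≤ r) :
    β + moment (fun t => Real.exp (g t)) r < 0 := by
  have h1 := hg.add_moment_nonpos (show 0 ≤ r + 1 by linarith)
  have hc : Continuous fun s => s * Real.exp (g s) := continuous_id.mul hg.exp_continuous
  have h2 := intervalIntegral.intervalIntegral_pos_of_pos_on (hc.intervalIntegrable r (r + 1))
    (fun s hs => mul_pos (hr.trans_lt hs.1) (Real.exp_pos _)) (by linarith)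
  have h3 := intervalIntegral.integral_add_adjacent_intervals
    (hc.intervalIntegrable (μ := volume) 0 r) (hc.intervalIntegrable r (r + 1))
  simp only [moment] at h1 ⊢
  linarith

theorem IsProfile.le_mul_sq (hg : IsProfile β g) {r : ℝ} (hr : 0 ≤ r) :
    g r ≤ (β + moment (fun t => Real.exp (g t)) r) * r ^ 2 / 6 := by
  conv_lhs => rw [hg.eq r hr]
  exact invLap_add_invLap_le hg.exp_continuous (fun s _ => (Real.exp_pos _).le) β hr

theorem IsProfile.nonpos (hg : IsProfile β g) {r : ℝ} (hr : 0 ≤ r) : g r ≤ 0 := by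
  have := hg.le_mul_sq hr
  have := hg.add_moment_nonpos hr
  nlinarith [sq_nonneg r]

theorem IsProfile.isAdmissible (hg : IsProfile β g) : IsAdmissible β := fun n _ hr =>
  (hg.expIter_le n hr).trans (Real.exp_le_one_iff.2 (hg.nonpos hr))

theorem IsAdmissible.neg (h : IsAdmissible β) : β < 0 := by
  obtain ⟨g, hg⟩ := h.exists_isProfile
  simpa using hg.add_moment_neg le_rfl

theorem exists_isEntireRadialSolution_iff :
    (∃ u : E3 → ℝ, IsEntireRadialSolution β u) ↔ IsAdmissible β := by
  constructor
  · rintro ⟨u, hu⟩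
    obtain ⟨e, he⟩ := exists_norm_eq E3 zero_le_one
    exact (hu.isProfile he).isAdmissible
  · intro h
    obtain ⟨g, hg⟩ := h.exists_isProfile
    exact hg.exists_isEntireRadialSolution

end Profile

/-! ### Increasing the parameter -/

section Perturbation

variable {β : ℝ} {g : ℝ → ℝ}

/-- The weight e^(3Rs) makes the integral operators contract by 1/3 on [0, R], since s ≤ R there. -/
theorem moment_exp_le {c R r : ℝ} (hc : 0 ≤ c) (hr : 0 ≤ r) (hrR : r ≤ R) :
    moment (fun s => c * Real.exp (3 * R * s)) r ≤ c / 3 * Real.exp (3 * R * r) := by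
  have := le_of_hasDerivAt_nonneg hr
    (f := fun r => c / 3 * Real.exp (3 * R * r) - moment (fun s => c * Real.exp (3 * R * s)) r)
    (fun s _ _ => ((((hasDerivAt_id s).const_mul (3 * R)).exp.const_mul (c / 3)).sub
      (hasDerivAt_moment (by fun_prop) s)))
    (fun s hs hs' => ?_)
  · simp only [mul_zero, Real.exp_zero, mul_one, moment_zero, sub_zero] at this
    linarith
  · have h1 : 0 ≤ c * Real.exp (3 * R * s) := by positivity
    simp only [id]
    nlinarith

theorem invLap_exp_le {c R r : ℝ} (hc : 0 ≤ c) (hr : 0 ≤ r) (hrR : r ≤ R) :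
    invLap (fun s => c * Real.exp (3 * R * s)) r ≤ c / 3 * Real.exp (3 * R * r) :=
  (invLap_le_moment (by fun_prop) (fun s _ => by positivity) hr).trans
    (moment_exp_le hc hr hrR)

theorem exp_add_le {x y : ℝ} (hx : x ≤ 0) (hy : 0 ≤ y) (hy1 : y ≤ 1) :
    Real.exp (x + y) ≤ Real.exp x + 2 * y := by
  have h1 := abs_le.1 (Real.abs_exp_sub_one_sub_id_le (x := y) (by rwa [abs_of_nonneg hy]))
  have h2 := Real.exp_le_one_iff.2 hx
  have h3 := Real.exp_pos x
  rw [Real.exp_add]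
  nlinarith

theorem IsProfile.expIter_succ_le (hg : IsProfile β g) {ε R : ℝ} (hR : 0 < R) (hε : 0 ≤ ε)
    (hεR : ε * Real.exp (3 * R * R) ≤ 1) {n : ℕ}
    (ih : ∀ s, 0 ≤ s → s ≤ R →
      expIter (β + ε) n s ≤ Real.exp (g s) + 2 * ε * Real.exp (3 * R * s))
    {s : ℝ} (hs : 0 ≤ s) (hsR : s ≤ R) :
    expIter (β + ε) (n + 1) s ≤ Real.exp (g s) + 2 * ε * Real.exp (3 * R * s) := by
  have hk := hg.exp_continuous
  have hLk := continuous_invLap hk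
  have hLi := continuous_invLap (continuous_expIter (β + ε) n)
  have h1 : invLap (fun t => β + ε + invLap (expIter (β + ε) n) t) s
      ≤ g s + ε * Real.exp (3 * R * s) := by
    -- The coefficient 5/3 is 1 from the shift of β plus 2/3 from the inductive error; the outer
    -- inversion reduces it to 5/9 ≤ 1.
    have h2 : invLap (fun t => β + ε + invLap (expIter (β + ε) n) t) s
        ≤ invLap (fun t => (β + invLap (fun t => Real.exp (g t)) t)
          + 5 / 3 * ε * Real.exp (3 * R * t)) s := by
      refine invLap_mono hs (by fun_prop) (by fun_prop) fun t ht hts => ?_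
      have htR := hts.trans hsR
      have h3 := invLap_mono ht (continuous_expIter (β + ε) n)
        (k := fun s => Real.exp (g s) + 2 * ε * Real.exp (3 * R * s)) (by fun_prop)
        fun x hx hxt => ih x hx (hxt.trans htR)
      rw [invLap_add hk (by fun_prop)] at h3
      have h4 := invLap_exp_le (c := 2 * ε) (by positivity) ht htR
      have h5 : 1 ≤ Real.exp (3 * R * t) := Real.one_le_exp (by positivity)
      nlinarith
    rw [invLap_add (h := fun t => β + invLap (fun t => Real.exp (g t)) t) (by fun_prop)
      (by fun_prop), ← hg.eq s hs] at h2
    have h4 := invLap_exp_le (c := 5 / 3 * ε) (by positivity) hs hsR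
    have h5 : 0 ≤ ε * Real.exp (3 * R * s) := by positivity
    linarith
  have h6 : ε * Real.exp (3 * R * s) ≤ 1 := by
    refine le_trans ?_ hεR
    gcongr
  calc expIter (β + ε) (n + 1) s ≤ Real.exp (g s + ε * Real.exp (3 * R * s)) :=
        Real.exp_le_exp.2 h1
    _ ≤ _ := by
      have := exp_add_le (hg.nonpos hs) (by positivity) h6
      linarith

/-- If the Laplacian stays away from zero, then the parameter can be increased. -/
theorem IsProfile.exists_isAdmissible_add (hg : IsProfile β g) {δ : ℝ} (hδ : 0 < δ)
    (H : ∀ r, 0 ≤ r → β + moment (fun t => Real.exp (g t)) r ≤ -δ) :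
    ∃ ε > 0, IsAdmissible (β + ε) := by
  have hk := hg.exp_continuous
  -- A third derivative at most -δ/2 gives, after the factor r²/6, exactly this Gaussian rate.
  set a := δ / 12 with ha
  have hapos : 0 < a := by positivity
  have hlim : Tendsto (fun R : ℝ => Real.exp (-a * R ^ 2)) atTop (𝓝 0) :=
    Real.tendsto_exp_atBot.comp
      ((tendsto_pow_atTop two_ne_zero).const_mul_atTop_of_neg (neg_neg_of_pos hapos))
  -- Beyond `R` the Gaussian contributes at most δ/4 to the moment.
  obtain ⟨R, hRtail, hR1⟩ := ((hlim.eventually_le_const (u := 2 * a * (δ / 4))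
    (by positivity)).and (eventually_ge_atTop 1)).exists
  have hR : 0 < R := by linarith
  have hE : 1 ≤ Real.exp (3 * R * R) := Real.one_le_exp (by positivity)
  set ε := min 1 (δ / 8) / Real.exp (3 * R * R) with hε
  have hε0 : 0 < ε := by positivity
  have hεE : ε * Real.exp (3 * R * R) = min 1 (δ / 8) := by rw [hε]; field_simp
  have hεE1 : ε * Real.exp (3 * R * R) ≤ 1 := hεE.trans_le (min_le_left _ _)
  have hεE2 : ε * Real.exp (3 * R * R) ≤ δ / 8 := hεE.trans_le (min_le_right _ _)
  -- The two bounds close together: nearness to e^g on [0, R] leaves the third derivative at most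
  -- -3δ/4 there, and the Gaussian tail raises it to at most -δ/2 everywhere.
  have key : ∀ n, (∀ s, 0 ≤ s → s ≤ R →
        expIter (β + ε) n s ≤ Real.exp (g s) + 2 * ε * Real.exp (3 * R * s)) ∧
      ∀ s, 0 ≤ s → expIter (β + ε) n s ≤ Real.exp (-a * s ^ 2) := by
    intro n
    induction n with
    | zero => exact ⟨fun s _ _ => by simp only [expIter]; positivity,
        fun s _ => by simp only [expIter]; positivity⟩
    | succ n ih =>
      refine ⟨fun s hs hsR => hg.expIter_succ_le hR hε0.le hεE1 ih.1 hs hsR, fun r hr => ?_⟩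
      have hi := continuous_expIter (β + ε) n
      have hi0 : ∀ s, 0 ≤ s → 0 ≤ expIter (β + ε) n s := fun s _ => expIter_nonneg _ _ _
      have h1 : β + ε + moment (expIter (β + ε) n) R ≤ -(3 * δ / 4) := by
        have h2 := moment_mono hR.le hi
          (k := fun s => Real.exp (g s) + 2 * ε * Real.exp (3 * R * s)) (by fun_prop) ih.1
        rw [moment_add hk (by fun_prop)] at h2
        have h3 := moment_exp_le (c := 2 * ε) (by positivity) hR.le le_rfl
        have h4 := H R hR.le
        nlinarith
      have h5 : β + ε + moment (expIter (β + ε) n) r ≤ -(δ / 2) := by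
        rcases le_total r R with h | h
        · have := moment_le_moment hi hi0 hr h
          linarith
        · have h6 := le_of_hasDerivAt_nonneg h
            (f := fun r => moment (fun s => Real.exp (-a * s ^ 2)) r
              - moment (expIter (β + ε) n) r)
            (fun s _ _ => (hasDerivAt_moment (by fun_prop) s).sub (hasDerivAt_moment hi s))
            (fun s hs _ => by
              have h0 := hR.trans hs
              exact sub_nonneg.2 (mul_le_mul_of_nonneg_left (ih.2 s h0.le) h0.le))
          rw [moment_gaussian hapos.ne', moment_gaussian hapos.ne'] at h6
          have h7 : (1 - Real.exp (-a * r ^ 2)) / (2 * a) ≤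
              (1 - Real.exp (-a * R ^ 2)) / (2 * a) + δ / 4 := by
            rw [div_add' _ _ _ (by positivity)]
            have := Real.exp_pos (-a * r ^ 2)
            gcongr
            linarith
          linarith
      refine Real.exp_le_exp.2 ((invLap_add_invLap_le hi hi0 (β + ε) hr).trans ?_)
      rw [ha]
      nlinarith [sq_nonneg r]
  refine ⟨ε, hε0, fun n r hr => ((key n).2 r hr).trans (Real.exp_le_one_iff.2 ?_)⟩
  nlinarith [sq_nonneg r]

end Perturbation

/-! ### Exponential decay and the expansion at infinity -/

section ExponentialDecay

variable {f : ℝ → ℝ} {b : ℝ}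

theorem isBigO_pow_mul_exp (j : ℕ) (hb : 0 < b) (hf : f =O[atTop] fun r => Real.exp (-b * r)) :
    (fun r => r ^ j * f r) =O[atTop] fun r => Real.exp (-(b / 2) * r) := by
  refine ((isLittleO_pow_exp_pos_mul_atTop j (half_pos hb)).isBigO.mul hf).congr_right fun r => ?_
  rw [← Real.exp_add]
  ring_nf

theorem isBigO_tail (hb : 0 < b)
    (hf : f =O[atTop] fun r => Real.exp (-b * r)) :
    (fun r => ∫ s in Set.Ioi r, f s) =O[atTop] fun r => Real.exp (-b * r) := by
  obtain ⟨D, hD⟩ := hf.bound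
  obtain ⟨S, hS⟩ := eventually_atTop.1 hD
  refine IsBigO.of_bound (D / b) ?_
  filter_upwards [eventually_ge_atTop S] with r hr
  have hi : IntegrableOn (fun s => D * Real.exp (-b * s)) (Set.Ioi r) :=
    (integrableOn_exp_mul_Ioi (neg_neg_of_pos hb) r).const_mul D
  have h1 : ‖∫ s in Set.Ioi r, f s‖ ≤ ∫ s in Set.Ioi r, D * Real.exp (-b * s) := by
    refine norm_integral_le_of_norm_le hi
      ((ae_restrict_iff' measurableSet_Ioi).2 (ae_of_all _ fun s hs => ?_))
    simpa using hS s (hr.trans (le_of_lt hs))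
  refine h1.trans (le_of_eq ?_)
  rw [integral_const_mul, integral_exp_mul_Ioi (neg_neg_of_pos hb), Real.norm_eq_abs, Real.abs_exp]
  field_simp

end ExponentialDecay

section Expansion

variable {β : ℝ} {g : ℝ → ℝ}

/-- The integral equation with its kernel expanded. -/
theorem IsProfile.mul_eq_moments (hg : IsProfile β g) {r : ℝ} (hr : 0 ≤ r) :
    r * g r = β * r ^ 3 / 6 + r ^ 3 / 6 * (∫ s in (0 : ℝ)..r, s ^ 1 * Real.exp (g s))
      - r ^ 2 / 2 * (∫ s in (0 : ℝ)..r, s ^ 2 * Real.exp (g s))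
      + r / 2 * (∫ s in (0 : ℝ)..r, s ^ 3 * Real.exp (g s))
      - (∫ s in (0 : ℝ)..r, s ^ 4 * Real.exp (g s)) / 6 := by
  obtain ⟨y₀, y₁, y₂, d₀, d₁, d₂, z₀, z₁, z₂, h⟩ := hg.exists_system
  have hk := hg.exp_continuous
  set M : ℕ → ℝ → ℝ := fun j r => ∫ s in (0 : ℝ)..r, s ^ j * Real.exp (g s) with hM
  have dM : ∀ j r, HasDerivAt (M j) (r ^ j * Real.exp (g r)) r := fun j r =>
    (((continuous_pow j).mul hk).integral_hasStrictDerivAt 0 r).hasDerivAt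
  have M0 : ∀ j, M j 0 = 0 := fun j => by simp [hM]
  have hm : ∀ r, moment (fun t => Real.exp (g t)) r = M 1 r := fun r => by simp [hM, moment]
  have zero : ∀ f : ℝ → ℝ, (∀ r, HasDerivAt f 0 r) → f 0 = 0 → ∀ r, f r = 0 := by
    intro f hf h0 r
    rw [← h0]
    exact is_const_of_deriv_eq_zero (fun r => (hf r).differentiableAt) (fun r => (hf r).deriv) r 0
  -- Each formula is checked by comparing derivatives and values at 0; the terms containing e^g
  -- cancel on differentiation, up to the final one in `e₀`.
  have e₂ : ∀ r, y₂ r = β * r + r * M 1 r - M 2 r := by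
    intro r
    have := zero (fun r => y₂ r - (β * r + r * M 1 r - M 2 r))
      (fun r => ((d₂ r).sub ((((hasDerivAt_id r).const_mul β).add
        ((hasDerivAt_id r).mul (dM 1 r))).sub (dM 2 r))).congr_deriv
          (by rw [hm]; simp only [id]; ring)) (by simp [z₂, M0]) r
    linarith
  have e₁ : ∀ r, y₁ r = β * r ^ 2 / 2 + r ^ 2 / 2 * M 1 r - r * M 2 r + M 3 r / 2 := by
    intro r
    have := zero (fun r => y₁ r - (β * r ^ 2 / 2 + r ^ 2 / 2 * M 1 r - r * M 2 r + M 3 r / 2))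
      (fun r => ((d₁ r).sub ((((((hasDerivAt_pow 2 r).const_mul β).div_const 2).add
        (((hasDerivAt_pow 2 r).div_const 2).mul (dM 1 r))).sub
          ((hasDerivAt_id r).mul (dM 2 r))).add ((dM 3 r).div_const 2))).congr_deriv
          (by rw [e₂]; simp only [id]; push_cast; ring)) (by simp [z₁, M0]) r
    linarith
  have e₀ := zero (fun r => y₀ r - (β * r ^ 3 / 6 + r ^ 3 / 6 * M 1 r - r ^ 2 / 2 * M 2 r
      + r / 2 * M 3 r - M 4 r / 6))
      (fun r => ((d₀ r).sub (((((((hasDerivAt_pow 3 r).const_mul β).div_const 6).add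
        (((hasDerivAt_pow 3 r).div_const 6).mul (dM 1 r))).sub
          (((hasDerivAt_pow 2 r).div_const 2).mul (dM 2 r))).add
            (((hasDerivAt_id r).div_const 2).mul (dM 3 r))).sub
              ((dM 4 r).div_const 6))).congr_deriv
          (by rw [e₁]; simp only [id]; push_cast; ring)) (by simp [z₀, M0]) r
  rw [← h r hr]
  linarith

/-- Every profile lies below a decreasing affine function. -/
theorem IsProfile.exists_le_affine (hg : IsProfile β g) :
    ∃ a > 0, ∀ r, 0 ≤ r → g r ≤ a - a / 2 * r := by
  obtain ⟨y₀, y₁, y₂, d₀, d₁, d₂, z₀, z₁, z₂, h⟩ := hg.exists_system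
  set y₃ : ℝ → ℝ := fun r => β + moment (fun t => Real.exp (g t)) r with hy₃
  set a := -y₃ 1 with ha
  have hapos : 0 < a := neg_pos.2 (hg.add_moment_neg zero_le_one)
  have n₂ : ∀ r, 0 ≤ r → y₂ r ≤ 0 := fun r hr => by
    have := le_of_hasDerivAt_nonneg hr (f := fun r => -y₂ r) (fun s _ _ => (d₂ s).neg)
      fun s hs _ => neg_nonneg.2 (hg.add_moment_nonpos hs.le)
    simp only [z₂] at this
    linarith
  have b₂ : ∀ r, 1 ≤ r → y₂ r ≤ -a := fun r hr => by
    have h1 := le_of_hasDerivAt_nonneg (zero_le_one' ℝ) (f := fun r => y₃ 1 * r - y₂ r)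
      (fun s _ _ => ((hasDerivAt_id s).const_mul (y₃ 1)).sub (d₂ s))
      fun s hs hs' => by
        have := hg.add_moment_mono hs.le hs'.le
        simp only [mul_one, hy₃]; linarith
    have h2 := le_of_hasDerivAt_nonneg hr (f := fun r => -y₂ r) (fun s _ _ => (d₂ s).neg)
      fun s hs _ => neg_nonneg.2 (hg.add_moment_nonpos (zero_le_one.trans hs.le))
    simp only [z₂] at h1 h2
    linarith
  have n₁ : y₁ 1 ≤ 0 := by
    have := le_of_hasDerivAt_nonneg (zero_le_one' ℝ) (f := fun r => -y₁ r)
      (fun s _ _ => (d₁ s).neg) fun s hs _ => neg_nonneg.2 (n₂ s hs.le)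
    simp only [z₁] at this
    linarith
  have b₁ : ∀ r, 1 ≤ r → y₁ r ≤ -a * (r - 1) := fun r hr => by
    have := le_of_hasDerivAt_nonneg hr (f := fun r => -a * (r - 1) - y₁ r)
      (fun s _ _ => (((hasDerivAt_id s).sub_const 1).const_mul (-a)).sub (d₁ s))
      fun s hs _ => by have := b₂ s hs.le; linarith
    linarith
  refine ⟨a, hapos, fun r hr => ?_⟩
  rcases le_total r 1 with h1 | h1
  · have := hg.nonpos hr
    nlinarith
  · have h2 := le_of_hasDerivAt_nonneg h1 (f := fun r => -a * (r - 1) ^ 2 / 2 - y₀ r)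
      (f' := fun r => -a * (r - 1) - y₁ r)
      (fun s _ _ => ((((((hasDerivAt_id s).sub_const 1).pow 2).const_mul (-a)).div_const 2).sub
        (d₀ s)).congr_deriv (by simp only [id]; push_cast; ring))
      fun s hs _ => by have := b₁ s hs.le; linarith
    have h3 := hg.nonpos zero_le_one
    rw [h r hr, h 1 zero_le_one] at h2
    -- Three integrations give r g(r) ≤ -a (r - 1)² / 2, and (r - 1)² ≥ r² - 2 r.
    have h4 : r * g r ≤ r * (a - a / 2 * r) := by nlinarith
    exact le_of_mul_le_mul_left h4 (by linarith)

theorem IsProfile.exists_isBigO (hg : IsProfile β g) : ∃ b > 0, ∀ j : ℕ,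
    (fun r => r ^ j * Real.exp (g r)) =O[atTop] fun r => Real.exp (-b * r) := by
  obtain ⟨a, ha, h⟩ := hg.exists_le_affine
  refine ⟨a / 2 / 2, by positivity, fun j => isBigO_pow_mul_exp j (by positivity) ?_⟩
  refine IsBigO.of_bound (Real.exp a) ?_
  filter_upwards [eventually_ge_atTop 0] with r hr
  rw [Real.norm_eq_abs, Real.norm_eq_abs, Real.abs_exp, Real.abs_exp, ← Real.exp_add]
  exact Real.exp_le_exp.2 (by have := h r hr; linarith)

theorem IsProfile.integrableOn (hg : IsProfile β g) (j : ℕ) :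
    IntegrableOn (fun r => r ^ j * Real.exp (g r)) (Set.Ioi 0) := by
  obtain ⟨b, hb, h⟩ := hg.exists_isBigO
  exact integrable_of_isBigO_exp_neg hb
    ((continuous_pow j).mul hg.exp_continuous).continuousOn (h j)

/-- Expansion of a profile at infinity when its Laplacian tends to zero. -/
theorem IsProfile.isBigO_expansion (hg : IsProfile β g)
    (H : ∀ δ > 0, ∃ r, 0 ≤ r ∧ -δ < β + moment (fun t => Real.exp (g t)) r) :
    ∃ c > 0, (fun r => g r - (-(∫ s in Set.Ioi (0 : ℝ), s ^ 2 * Real.exp (g s)) / 2 * r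
      + (∫ s in Set.Ioi (0 : ℝ), s ^ 3 * Real.exp (g s)) / 2
      - (∫ s in Set.Ioi (0 : ℝ), s ^ 4 * Real.exp (g s)) / 6 * r⁻¹))
        =O[atTop] fun r => Real.exp (-(c * r)) := by
  obtain ⟨b, hb, hO⟩ := hg.exists_isBigO
  have hk := hg.exp_continuous
  set I : ℕ → ℝ := fun j => ∫ s in Set.Ioi (0 : ℝ), s ^ j * Real.exp (g s) with hI
  set t : ℕ → ℝ → ℝ := fun j r => ∫ s in Set.Ioi r, s ^ j * Real.exp (g s) with ht
  have split : ∀ j r, 0 ≤ r → ∫ s in (0 : ℝ)..r, s ^ j * Real.exp (g s) = I j - t j r := by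
    intro j r hr
    have := intervalIntegral.integral_interval_add_Ioi (hg.integrableOn j)
      ((hg.integrableOn j).mono_set (Set.Ioi_subset_Ioi hr))
    simp only [hI, ht]
    linarith
  -- `H` forces the limit of the third derivative to be 0, which removes the quadratic term of g.
  have hI1 : I 1 = -β := by
    have hlim : Tendsto (fun r => β + moment (fun t => Real.exp (g t)) r) atTop
        (𝓝 (β + I 1)) := by
      have := intervalIntegral_tendsto_integral_Ioi 0 (hg.integrableOn 1) tendsto_id
      simpa only [moment, pow_one, hI, id] using this.const_add β
    have h1 : β + I 1 ≤ 0 := le_of_tendsto hlim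
      ((eventually_ge_atTop 0).mono fun r hr => hg.add_moment_nonpos hr)
    have h2 : 0 ≤ β + I 1 := by
      refine le_of_forall_pos_lt_add fun δ hδ => ?_
      obtain ⟨r, hr, hlt⟩ := H δ hδ
      have : β + moment (fun t => Real.exp (g t)) r ≤ β + I 1 := ge_of_tendsto hlim
        ((eventually_ge_atTop r).mono fun s hs => hg.add_moment_mono hr hs)
      linarith
    linarith
  have hT : ∀ i j, (fun r => r ^ i * t j r) =O[atTop] fun r => Real.exp (-(b / 2) * r) :=
    fun i j => isBigO_pow_mul_exp i hb
      (isBigO_tail hb (hO j))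
  have hsum := (((((hT 3 1).const_mul_left (-(1 / 6))).add
    ((hT 2 2).const_mul_left (1 / 2))).add ((hT 1 3).const_mul_left (-(1 / 2)))).add
      ((hT 0 4).const_mul_left (1 / 6)))
  refine ⟨b / 2, by positivity, IsBigO.trans (IsBigO.of_bound 1 ?_)
    (hsum.congr_right fun r => by rw [neg_mul])⟩
  filter_upwards [eventually_ge_atTop 1] with r hr
  have hr0 : 0 < r := by linarith
  have h1 := hg.mul_eq_moments hr0.le
  rw [split 1 r hr0.le, split 2 r hr0.le, split 3 r hr0.le, split 4 r hr0.le, hI1] at h1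
  -- After the cancellation only powers of r times tails of moments remain.
  have h2 : g r - (-I 2 / 2 * r + I 3 / 2 - I 4 / 6 * r⁻¹) = r⁻¹ *
      (-(1 / 6) * (r ^ 3 * t 1 r) + 1 / 2 * (r ^ 2 * t 2 r) + -(1 / 2) * (r ^ 1 * t 3 r)
        + 1 / 6 * (r ^ 0 * t 4 r)) := by
    have h3 : g r = r⁻¹ * (r * g r) := by field_simp
    rw [h3, h1]
    field_simp
    ring
  rw [h2, norm_mul, one_mul, norm_inv, Real.norm_eq_abs, abs_of_pos hr0]
  exact mul_le_of_le_one_left (norm_nonneg _) (inv_le_one_of_one_le₀ hr)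

end Expansion

/-! ### Polar coordinates -/

theorem integral_fun_norm_E3 (f : ℝ → ℝ) :
    ∫ x : E3, f ‖x‖ = 4 * Real.pi * ∫ r in Set.Ioi (0 : ℝ), r ^ 2 * f r := by
  rw [integral_fun_norm_addHaar, measureReal_def, EuclideanSpace.volume_ball_fin_three,
    finrank_euclideanSpace_fin]
  have : 0 ≤ Real.pi * 4 / 3 := by positivity
  simp [this]
  ring

theorem integrable_fun_norm_E3 {f : ℝ → ℝ} :
    Integrable (fun x : E3 => f ‖x‖) ↔ IntegrableOn (fun r => r ^ 2 * f r) (Set.Ioi 0) := by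
  rw [integrable_fun_norm_addHaar, finrank_euclideanSpace_fin]
  simp

end

end

/-- There is a critical parameter `β₀ < 0`, and the separatrix has the stated expansion. -/
theorem theorem1p3 :
    ∃ β₀ : ℝ, β₀ < 0 ∧ IsCriticalParameter β₀ ∧
      ∀ u : E3 → ℝ, IsEntireRadialSolution β₀ u →
        Integrable (fun x : E3 => Real.exp (u x)) ∧
        Integrable (fun x : E3 => ‖x‖ * Real.exp (u x)) ∧
        Integrable (fun x : E3 => ‖x‖ ^ 2 * Real.exp (u x)) ∧
        ∃ c : ℝ, 0 < c ∧
          (fun x : E3 => u x -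
              ((-1 / (8 * Real.pi) * ∫ y : E3, Real.exp (u y)) * ‖x‖
                + (1 / (8 * Real.pi) * ∫ y : E3, ‖y‖ * Real.exp (u y))
                + (-1 / (24 * Real.pi) * ∫ y : E3, ‖y‖ ^ 2 * Real.exp (u y)) * ‖x‖⁻¹))
            =O[cocompact E3] (fun x : E3 => Real.exp (-(c * ‖x‖))) := by
  set S : Set ℝ := {β | IsAdmissible β} with hS
  have hbdd : BddAbove S := ⟨0, fun β hβ => IsAdmissible.neg hβ |>.le⟩
  have hmem : IsAdmissible (sSup S) :=
    isClosed_isAdmissible.csSup_mem ⟨-7, isAdmissible_neg_seven⟩ hbdd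
  refine ⟨sSup S, hmem.neg, fun β => exists_isEntireRadialSolution_iff.trans
    ⟨fun h => le_csSup hbdd h, hmem.mono⟩, fun u hu => ?_⟩
  obtain ⟨e, he⟩ := exists_norm_eq E3 zero_le_one
  have hg := hu.isProfile he
  set g : ℝ → ℝ := fun s => u (s • e) with hgdef
  have hug : ∀ x, u x = g ‖x‖ := fun x => hu.radial _ _ (by simp [norm_smul, he])
  -- Otherwise the parameter could be raised beyond the supremum of the admissible set.
  have H : ∀ δ > 0, ∃ r, 0 ≤ r ∧ -δ < sSup S + moment (fun t => Real.exp (g t)) r := by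
    intro δ hδ
    by_contra! hcon
    obtain ⟨ε, hε, had⟩ := hg.exists_isAdmissible_add hδ hcon
    have : sSup S + ε ≤ sSup S := le_csSup hbdd had
    linarith
  clear_value g
  obtain rfl : u = fun x => g ‖x‖ := funext hug
  have i₀ := integrable_fun_norm_E3 (f := fun r => Real.exp (g r))
  have i₁ := integrable_fun_norm_E3 (f := fun r => r * Real.exp (g r))
  have i₂ := integrable_fun_norm_E3 (f := fun r => r ^ 2 * Real.exp (g r))
  have v₀ := integral_fun_norm_E3 (fun r => Real.exp (g r))
  have v₁ := integral_fun_norm_E3 (fun r => r * Real.exp (g r))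
  have v₂ := integral_fun_norm_E3 (fun r => r ^ 2 * Real.exp (g r))
  simp only [← mul_assoc, ← pow_succ, ← pow_add, Nat.reduceAdd] at i₁ i₂ v₁ v₂
  refine ⟨i₀.2 (hg.integrableOn 2), i₁.2 (hg.integrableOn 3), i₂.2 (hg.integrableOn 4), ?_⟩
  obtain ⟨c, hc, hO⟩ := hg.isBigO_expansion H
  refine ⟨c, hc, (hO.comp_tendsto (tendsto_norm_cocompact_atTop (E := E3))).congr_left
    fun x => ?_⟩
  simp only [v₀, v₁, v₂, Function.comp]
  have := Real.pi_pos.ne'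
  field_simp
  ring
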